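/- Let $\mathbb R\langle x_1,x_2\rangle$ be the algebra of noncommutative (NC) polynomials with real coefficients in two symmetric variables; the transpose $p\mapsto p^T$ is the linear map reversing each word, and $p$ is symmetric if $p^T=p$. For an additional symmetric noncommuting variable $h$ let $D[p,x_i,h]=\frac{d}{dt}p(\dots,x_i+th,\dots)|_{t=0}$ and $$\mathrm{Lap}[p,h]=\sum_{i=1}^{2} D\bigl[D[p,x_i,h],x_i,h\bigr].$$ A polynomial is matrix positive if it is symmetric and takes positive semidefinite values whenever its variables are replaced by real symmetric $n\times n$ matrices, for every $n$. Call $p$ harmonic if $\mathrm{Lap}[p,h]=0$, subharmonic if $\mathrm{Lap}[p,h]$ is matrix positive (as a polynomial in $x_1,x_2,h$), and purely subharmonic if it is subharmonic but not harmonic. "Homogeneous of degree $d$" means a real linear combination of words of length $d$ (zero is allowed). Put $\gamma=x_1+i\,x_2$; $\operatorname{Re}$ and $\operatorname{Im}$ of an NC polynomial with complex coefficients are taken coefficientwise. All coefficients below are real. **Theorem.** The homogeneous NC polynomials in two symmetric variables which are (1a) harmonic of degree $d>2$ are exactly the linear combinations of $\operatorname{Re}(\gamma^d)$ and $\operatorname{Im}(\gamma^d)$;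 (1b) harmonic of degree $2$ are exactly the linear combinations of $\operatorname{Re}(\gamma^2)$, $\operatorname{Im}(\gamma^2)$ and $x_1x_2$ (this includes $x_2x_1$); (2a) subharmonic of degree $2d$ with $d>2$ are exactly the polynomials $$c_0[\operatorname{Re}(\gamma^d)]^2+c_1\operatorname{Re}(\gamma^{2d})+c_2\operatorname{Im}(\gamma^{2d})=c_0[\operatorname{Im}(\gamma^d)]^2+(c_0+c_1)\operatorname{Re}(\gamma^{2d})+c_2\operatorname{Im}(\gamma^{2d})$$ with $c_0\ge 0$; (2b) symmetric and subharmonic of degree $4$ are exactly the polynomials $$\begin{aligned}f={}&B_1(x_1^4-x_1^2x_2^2-x_2^2x_1^2+x_2^4)+B_2(x_1^3x_2+x_2x_1^3-x_2x_1x_2^2-x_2^2x_1x_2)\\&+B_3(x_1^2x_2x_1+x_1x_2x_1^2-x_1x_2^3-x_2^3x_1)+B_4(x_1x_2x_1x_2+x_2x_1x_2x_1)\\&+B_5\,x_1x_2^2x_1+B_6\,x_2x_1^2x_2\end{aligned}$$ with $$(B_1+B_6)(B_1+B_5)\ \ge\ (B_3-B_2)^2+(B_1+B_4)^2,\qquad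 B_1+B_6\ge 0,\qquad B_1+B_5\ge 0;$$ when the first inequality is strict, $B_1+B_6>0$ and $B_1+B_5>0$ are equivalent; the six parameters are independent ($f=0$ only if all $B_j=0$); (2c) subharmonic of degree $2$ are exactly the polynomials $A_1x_1^2+A_2x_2^2+A_3x_1x_2+A_4x_2x_1$ with $A_1+A_2\ge 0$; (3) purely subharmonic of odd degree do not exist. Moreover, all the functions listed above except $x_1x_2$ and $x_2x_1$ in (1b) and (2c) are symmetric: $\operatorname{Re}(\gamma^d)$, $\operatorname{Im}(\gamma^d)$ and their squares for every $d$, every $f$ in (2b), $x_1^2$ and $x_2^2$ are symmetric, while $x_1x_2$ and $x_2x_1$ are not. -/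

import Mathlib

noncomputable section

/-- Noncommutative polynomials with real coefficients in the variables indexed by `ι`. -/
abbrev NCPoly (ι : Type) : Type := FreeAlgebra ℝ ι

namespace NCPoly

/-- The polynomials that are homogeneous of degree `d` (zero included): the real linear
combinations of the words of length `d`. -/
def homogeneous (ι : Type) (d : ℕ) : Submodule ℝ (NCPoly ι) :=
  Submodule.span ℝ (Set.range fun w : Fin d → ι => (List.ofFn fun k => FreeAlgebra.ι ℝ (w k)).prod)

/-- `p` is symmetric: `pᵀ = p`. The transpose of a polynomial in symmetric variables is Mathlib's
`star` on the free algebra: it reverses every word and fixes the real coefficients. -/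
def IsSymm {ι : Type} (p : NCPoly ι) : Prop := star p = p

/-- The value `p(X)` at a tuple of `n × n` matrices. -/
def evalMat {ι : Type} {n : ℕ} (X : ι → Matrix (Fin n) (Fin n) ℝ) (p : NCPoly ι) :
    Matrix (Fin n) (Fin n) ℝ :=
  FreeAlgebra.lift ℝ X p

/-- `p` is matrix positive: it is symmetric, and it takes positive semidefinite values at all
tuples of real symmetric matrices of every size. -/
def IsMatrixPositive {ι : Type} (p : NCPoly ι) : Prop :=
  IsSymm p ∧ ∀ (n : ℕ) (X : ι → Matrix (Fin n) (Fin n) ℝ),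
    (∀ i, (X i).IsSymm) → (evalMat X p).PosSemidef

/-- Polynomials in `x` and `h`: the variable `none` is `h`, and `some i` is `x i`. -/
abbrev WithDir (ι : Type) : Type := NCPoly (Option ι)

/-- The direction variable `h`. -/
def dirVar (ι : Type) : WithDir ι := FreeAlgebra.ι ℝ (none : Option ι)

/-- A polynomial in `x`, regarded as a polynomial in `x` and `h`. -/
def incl {ι : Type} : NCPoly ι →ₐ[ℝ] WithDir ι :=
  FreeAlgebra.lift ℝ fun i => FreeAlgebra.ι ℝ (some i)

/-- The substitution `x i ↦ x i + t h` (all other variables are kept), whose result is a polynomial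
in a central real parameter `t` with coefficients in the noncommutative polynomials. -/
def shift {ι : Type} [DecidableEq ι] (i : ι) : WithDir ι →ₐ[ℝ] Polynomial (WithDir ι) :=
  FreeAlgebra.lift ℝ fun v : Option ι =>
    Polynomial.C (FreeAlgebra.ι ℝ v) +
      if v = some i then Polynomial.X * Polynomial.C (dirVar ι) else 0

/-- The directional derivative in `x i` in the direction `h`:
`d/dt p(x₁, …, x i + t h, …, x_g)` at `t = 0`. -/
def dirDeriv {ι : Type} [DecidableEq ι] (i : ι) (p : WithDir ι) : WithDir ι :=
  (Polynomial.derivative (shift i p)).eval 0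

/-- The noncommutative Laplacian: the sum over `i` of the iterated derivatives in `x i` in the
direction `h`. -/
def lap {ι : Type} [Fintype ι] [DecidableEq ι] (p : NCPoly ι) : WithDir ι :=
  ∑ i, dirDeriv i (dirDeriv i (incl p))

/-- `p` is harmonic: its Laplacian is zero. -/
def IsHarmonic {ι : Type} [Fintype ι] [DecidableEq ι] (p : NCPoly ι) : Prop := lap p = 0

/-- `p` is subharmonic: its Laplacian is matrix positive. -/
def IsSubharmonic {ι : Type} [Fintype ι] [DecidableEq ι] (p : NCPoly ι) : Prop :=
  IsMatrixPositive (lap p)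

/-- `p` is purely subharmonic: subharmonic but not harmonic. -/
def IsPurelySubharmonic {ι : Type} [Fintype ι] [DecidableEq ι] (p : NCPoly ι) : Prop :=
  IsSubharmonic p ∧ ¬ IsHarmonic p

/-- The variable `x₁`. -/
def x₁ : NCPoly (Fin 2) := FreeAlgebra.ι ℝ 0

/-- The variable `x₂`. -/
def x₂ : NCPoly (Fin 2) := FreeAlgebra.ι ℝ 1

/-- `γ = x₁ + i x₂`, a noncommutative polynomial with complex coefficients. -/
def gamma : FreeAlgebra ℂ (Fin 2) := FreeAlgebra.ι ℂ 0 + Complex.I • FreeAlgebra.ι ℂ 1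

/-- Apply an additive map to every coefficient of a noncommutative polynomial. -/
def mapCoeff {ι : Type} (f : ℂ →+ ℝ) (q : FreeAlgebra ℂ ι) : NCPoly ι :=
  FreeAlgebra.equivMonoidAlgebraFreeMonoid.symm
    (MonoidAlgebra.map f (FreeAlgebra.equivMonoidAlgebraFreeMonoid q))

/-- The coefficientwise real part. -/
def re {ι : Type} (q : FreeAlgebra ℂ ι) : NCPoly ι := mapCoeff Complex.reAddGroupHom q

/-- The coefficientwise imaginary part. -/
def im {ι : Type} (q : FreeAlgebra ℂ ι) : NCPoly ι := mapCoeff Complex.imAddGroupHom q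

/-- The six-parameter family of quartics in two variables. -/
def quartic (B₁ B₂ B₃ B₄ B₅ B₆ : ℝ) : NCPoly (Fin 2) :=
  B₁ • (x₁ ^ 4 - x₁ ^ 2 * x₂ ^ 2 - x₂ ^ 2 * x₁ ^ 2 + x₂ ^ 4)
    + B₂ • (x₁ ^ 3 * x₂ + x₂ * x₁ ^ 3 - x₂ * x₁ * x₂ ^ 2 - x₂ ^ 2 * x₁ * x₂)
    + B₃ • (x₁ ^ 2 * x₂ * x₁ + x₁ * x₂ * x₁ ^ 2 - x₁ * x₂ ^ 3 - x₂ ^ 3 * x₁)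
    + B₄ • (x₁ * x₂ * x₁ * x₂ + x₂ * x₁ * x₂ * x₁)
    + B₅ • (x₁ * x₂ ^ 2 * x₁)
    + B₆ • (x₂ * x₁ ^ 2 * x₂)

end NCPoly

end

/-! The coefficient of `lap p` at a word `a h m h b` is `2 * ∑ i, c (a x_i m x_i b)`, where `c` is
the coefficient function of `p`, and all its other coefficients vanish (`coeff_lap`,
`coeff_lap_eq_zero`). The Laplacian thus records all contractions of pairs of letters, and
everything is linear algebra on coefficient functions.

Harmonic polynomials: in degree at least three, vanishing of all contractions leaves two free values
(`eq_of_contraction_eq_zero`), and `Re γ^d`, `Im γ^d` realize them, because a word with `k` letters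
`x₂` has coefficient `I ^ k` in `γ^d`.

Subharmonic polynomials: a matrix positive polynomial is evaluated at the edge matrices of a path
labelled by a word `w`. The entry from the first to the last vertex is the coefficient of `w`, while
the diagonal entry at the first vertex involves only closed walks. If no closed walk spells a word
of the polynomial, that diagonal entry is zero, hence so is its row, hence so is the coefficient of
`w`. Parity of closed walks then disposes of odd degree. In degree `2 d` the same argument kills the
coefficients of `lap p` at words whose first `d` letters avoid `h`, and by symmetry those whose last
`d` letters do. So contractions inside either half of a word vanish. For `d > 2` the harmonic
classification applies to each half, `p` is a combination of products of `Re γ^d` and `Im γ^d`, and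
one scalar evaluation fixes the sign of `c₀` (`isSubharmonic_iff_exists`).

In degree four the halves are too short for this, and the half-word relations leave the
six-parameter family. Its Laplacian is a quadratic form in `h a`, `h b`, `a h`, `b h`: a sum of
squares (`quarticLap_sos`) gives sufficiency and explicit 5 × 5 matrices give necessity. In degree
two the Laplacian is a multiple of `h ^ 2`. -/

noncomputable section

/-! ### Words and their coefficients in a free algebra -/

namespace FreeAlgebra

variable {R : Type*} [CommSemiring R] {X : Type*}

/-- The monomial given by a list of letters. -/
def word (R : Type*) [CommSemiring R] {X : Type*} (l : List X) : FreeAlgebra R X :=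
  (l.map (ι R)).prod

@[simp]
theorem word_nil : word R ([] : List X) = 1 := rfl

@[simp]
theorem word_cons (v : X) (l : List X) : word R (v :: l) = ι R v * word R l := by
  simp [word]

theorem word_append (l m : List X) : word R (l ++ m) = word R l * word R m := by
  simp [word]

theorem equivMonoidAlgebraFreeMonoid_word (l : List X) :
    equivMonoidAlgebraFreeMonoid (word R l) =
      MonoidAlgebra.single (FreeMonoid.ofList l) (1 : R) := by
  induction l with
  | nil => simp [MonoidAlgebra.one_def]
  | cons v l ih =>
    rw [word_cons, map_mul, ih]
    simp [equivMonoidAlgebraFreeMonoid, MonoidAlgebra.single_mul_single]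

/-- The coefficient of a word in a noncommutative polynomial. -/
def coeff (l : List X) : FreeAlgebra R X →ₗ[R] R where
  toFun p := (equivMonoidAlgebraFreeMonoid p).coeff (FreeMonoid.ofList l)
  map_add' p q := by simp
  map_smul' r p := by simp

theorem coeff_word [DecidableEq X] (l m : List X) :
    coeff l (word R m) = if m = l then 1 else 0 := by
  classical
  simp only [coeff, LinearMap.coe_mk, AddHom.coe_mk, equivMonoidAlgebraFreeMonoid_word]
  rw [MonoidAlgebra.coeff_single, Finsupp.single_apply]
  simp

theorem coeff_injective {p q : FreeAlgebra R X} (h : ∀ l, coeff l p = coeff l q) : p = q := by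
  apply equivMonoidAlgebraFreeMonoid.injective
  ext l
  exact h l.toList

theorem span_word : Submodule.span R (Set.range (word R (X := X))) = ⊤ := by
  rw [eq_top_iff]
  rintro p -
  induction p using FreeAlgebra.induction with
  | grade0 r =>
    rw [Algebra.algebraMap_eq_smul_one]
    exact Submodule.smul_mem _ _ (Submodule.subset_span ⟨[], rfl⟩)
  | grade1 x => exact Submodule.subset_span ⟨[x], by simp⟩
  | mul a b ha hb =>
    have := Submodule.mul_mem_mul ha hb
    rw [Submodule.span_mul_span] at this
    refine Submodule.span_mono ?_ this
    rintro _ ⟨_, ⟨l, rfl⟩, _, ⟨m, rfl⟩, rfl⟩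
    exact ⟨l ++ m, word_append l m⟩
  | add a b ha hb => exact add_mem ha hb

theorem induction_word {P : FreeAlgebra R X → Prop} (hw : ∀ l, P (word R l)) (h0 : P 0)
    (hadd : ∀ p q, P p → P q → P (p + q)) (hsmul : ∀ (r : R) p, P p → P (r • p))
    (p : FreeAlgebra R X) : P p := by
  have hp : p ∈ Submodule.span R (Set.range (word R (X := X))) := by rw [span_word]; trivial
  induction hp using Submodule.span_induction with
  | mem x h => obtain ⟨l, rfl⟩ := h; exact hw l
  | zero => exact h0
  | add p q _ _ hp hq => exact hadd p q hp hq
  | smul r p _ hp => exact hsmul r p hp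

theorem coeff_cons_ι_mul [DecidableEq X] (u v : X) (l : List X) (p : FreeAlgebra R X) :
    coeff (v :: l) (ι R u * p) = if u = v then coeff l p else 0 := by
  induction p using induction_word with
  | hw m =>
    rw [← word_cons, coeff_word, coeff_word]
    by_cases h : u = v <;> simp [h]
  | h0 => simp
  | hadd p q hp hq => rw [mul_add, map_add, hp, hq]; split_ifs <;> simp
  | hsmul r p hp => rw [mul_smul_comm, map_smul, hp]; split_ifs <;> simp

theorem coeff_nil_ι_mul (u : X) (p : FreeAlgebra R X) : coeff [] (ι R u * p) = 0 := by
  classical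
  induction p using induction_word with
  | hw m => rw [← word_cons, coeff_word]; simp
  | h0 => simp
  | hadd p q hp hq => rw [mul_add, map_add, hp, hq, add_zero]
  | hsmul r p hp => rw [mul_smul_comm, map_smul, hp, smul_zero]

theorem star_word (l : List X) : star (word R l) = word R l.reverse := by
  induction l with
  | nil => simp
  | cons v l ih => rw [word_cons, star_mul, ih, List.reverse_cons, word_append]; simp

theorem star_smul_real (r : R) (p : FreeAlgebra R X) : star (r • p) = r • star p := by
  rw [Algebra.smul_def, star_mul, star_algebraMap, Algebra.smul_def, Algebra.commutes]

theorem coeff_star (l : List X) (p : FreeAlgebra R X) : coeff l (star p) = coeff l.reverse p := by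
  classical
  induction p using induction_word with
  | hw m =>
    rw [star_word, coeff_word, coeff_word]
    simp only [List.reverse_eq_iff]
  | h0 => simp
  | hadd p q hp hq => rw [star_add, map_add, hp, hq, map_add]
  | hsmul r p hp => rw [star_smul_real, map_smul, hp, map_smul]

end FreeAlgebra

open FreeAlgebra

/-! ### Homogeneous polynomials through their coefficients -/

namespace NCPoly

variable {ι : Type}

theorem word_ofFn {d : ℕ} (w : Fin d → ι) :
    word ℝ (List.ofFn w) = (List.ofFn fun k => FreeAlgebra.ι ℝ (w k)).prod := by
  rw [word, List.map_ofFn]; rfl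

theorem word_mem_homogeneous (l : List ι) : word ℝ l ∈ homogeneous ι l.length := by
  refine Submodule.subset_span ⟨l.get, ?_⟩
  have h := word_ofFn l.get
  rw [List.ofFn_get] at h
  exact h.symm

theorem homogeneous_induction {d : ℕ} {P : NCPoly ι → Prop}
    (hw : ∀ l : List ι, l.length = d → P (word ℝ l)) (h0 : P 0)
    (hadd : ∀ p q, P p → P q → P (p + q)) (hsmul : ∀ (r : ℝ) p, P p → P (r • p))
    {p : NCPoly ι} (hp : p ∈ homogeneous ι d) : P p := by
  induction hp using Submodule.span_induction with
  | mem x h =>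
    obtain ⟨w, rfl⟩ := h
    change P (List.ofFn fun k => FreeAlgebra.ι ℝ (w k)).prod
    rw [← word_ofFn]; exact hw _ (by simp)
  | zero => exact h0
  | add p q _ _ hp hq => exact hadd p q hp hq
  | smul r p _ hp => exact hsmul r p hp

theorem coeff_eq_zero_of_mem_homogeneous {d : ℕ} {p : NCPoly ι} (hp : p ∈ homogeneous ι d)
    {l : List ι} (hl : l.length ≠ d) : coeff l p = 0 := by
  classical
  refine homogeneous_induction (P := fun p => coeff l p = 0) ?_ (map_zero _) ?_ ?_ hp
  · intro m hm
    rw [coeff_word, if_neg]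
    rintro rfl
    exact hl hm
  · intro p q hp hq
    rw [map_add, hp, hq, add_zero]
  · intro r p hp
    rw [map_smul, hp, smul_zero]

theorem eq_sum_coeff_smul_word (p : NCPoly ι) :
    ∃ s : Finset (List ι), (∀ l ∉ s, coeff l p = 0) ∧ p = ∑ l ∈ s, coeff l p • word ℝ l := by
  classical
  have key : ∀ (s : Finset (List ι)) (c : List ι → ℝ) (m : List ι),
      coeff m (∑ l ∈ s, c l • word ℝ l) = if m ∈ s then c m else 0 := by
    intro s c m
    simp [map_sum, coeff_word]
  have : ∃ s : Finset (List ι), ∀ l ∉ s, coeff l p = 0 := by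
    induction p using induction_word with
    | hw m =>
      refine ⟨{m}, fun l hl => ?_⟩
      rw [coeff_word, if_neg]
      rintro rfl
      simp at hl
    | h0 => exact ⟨∅, by simp⟩
    | hadd p q hp hq =>
      obtain ⟨s, hs⟩ := hp
      obtain ⟨t, ht⟩ := hq
      refine ⟨s ∪ t, fun l hl => ?_⟩
      rw [Finset.mem_union, not_or] at hl
      rw [map_add, hs l hl.1, ht l hl.2, add_zero]
    | hsmul r p hp =>
      obtain ⟨s, hs⟩ := hp
      exact ⟨s, fun l hl => by rw [map_smul, hs l hl, smul_zero]⟩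
  obtain ⟨s, hs⟩ := this
  refine ⟨s, hs, coeff_injective fun m => ?_⟩
  rw [key]
  split_ifs with h
  · rfl
  · exact hs m h

theorem mem_homogeneous_iff {d : ℕ} {p : NCPoly ι} :
    p ∈ homogeneous ι d ↔ ∀ l : List ι, l.length ≠ d → coeff l p = 0 := by
  refine ⟨fun hp l hl => coeff_eq_zero_of_mem_homogeneous hp hl, fun h => ?_⟩
  obtain ⟨s, -, hs⟩ := eq_sum_coeff_smul_word p
  rw [hs]
  refine Submodule.sum_mem _ fun l _ => ?_
  by_cases hl : l.length = d
  · exact Submodule.smul_mem _ _ (hl ▸ word_mem_homogeneous l)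
  · rw [h l hl, zero_smul]; exact zero_mem _

theorem eq_of_coeff_eq {d : ℕ} {p q : NCPoly ι} (hp : p ∈ homogeneous ι d)
    (hq : q ∈ homogeneous ι d) (h : ∀ l : List ι, l.length = d → coeff l p = coeff l q) :
    p = q := by
  refine coeff_injective fun l => ?_
  by_cases hl : l.length = d
  · exact h l hl
  · rw [coeff_eq_zero_of_mem_homogeneous hp hl, coeff_eq_zero_of_mem_homogeneous hq hl]

theorem mul_mem_homogeneous {d e : ℕ} {p q : NCPoly ι} (hp : p ∈ homogeneous ι d)
    (hq : q ∈ homogeneous ι e) : p * q ∈ homogeneous ι (d + e) := by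
  refine homogeneous_induction (P := fun p => p * q ∈ homogeneous ι (d + e)) ?_ ?_ ?_ ?_ hp
  · intro l hl
    refine homogeneous_induction (P := fun q => word ℝ l * q ∈ homogeneous ι (d + e))
      ?_ ?_ ?_ ?_ hq
    · intro m hm
      rw [← word_append, ← hl, ← hm, ← List.length_append]
      exact word_mem_homogeneous _
    · simp
    · intro p q hp hq
      rw [mul_add]; exact add_mem hp hq
    · intro r p hp
      rw [mul_smul_comm]; exact Submodule.smul_mem _ _ hp
  · simp
  · intro p q hp hq
    rw [add_mul]; exact add_mem hp hq
  · intro r p hp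
    rw [smul_mul_assoc]; exact Submodule.smul_mem _ _ hp

/-- Homogeneity of `p` fixes the place where a word of `p * q` is cut, so the convolution sum for
the coefficient has a single term. -/
theorem coeff_append_mul {d : ℕ} {p : NCPoly ι} (hp : p ∈ homogeneous ι d) (q : NCPoly ι)
    {u : List ι} (v : List ι) (hu : u.length = d) :
    coeff (u ++ v) (p * q) = coeff u p * coeff v q := by
  classical
  have key : ∀ l u : List ι, l.length = u.length →
      coeff (u ++ v) (word ℝ l * q) = if l = u then coeff v q else 0 := by
    intro l
    induction l with
    | nil =>
      intro u h
      obtain rfl : u = [] := List.length_eq_zero_iff.mp h.symm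
      simp
    | cons a l ih =>
      rintro (_ | ⟨b, u⟩) h
      · simp at h
      · rw [word_cons, mul_assoc, List.cons_append, coeff_cons_ι_mul, ih u (by simpa using h)]
        by_cases hab : a = b <;> simp [hab]
  refine homogeneous_induction (P := fun p => coeff (u ++ v) (p * q) = coeff u p * coeff v q)
    ?_ ?_ ?_ ?_ hp
  · intro l hl
    rw [key l u (hl.trans hu.symm), coeff_word]
    split_ifs <;> simp
  · simp
  · intro p q hp hq
    rw [add_mul, map_add, hp, hq, map_add, add_mul]
  · intro r p hp
    rw [smul_mul_assoc, map_smul, hp, map_smul, smul_mul_assoc]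

theorem isSymm_iff_coeff {p : NCPoly ι} : IsSymm p ↔ ∀ l, coeff l.reverse p = coeff l p := by
  rw [IsSymm]
  constructor
  · intro h l
    conv_rhs => rw [← h]
    rw [coeff_star]
  · intro h
    refine coeff_injective fun l => ?_
    rw [coeff_star, h]

theorem coeff_mapCoeff (f : ℂ →+ ℝ) (q : FreeAlgebra ℂ ι) (l : List ι) :
    coeff l (mapCoeff f q) = f (coeff l q) := by
  simp [mapCoeff, coeff]

end NCPoly

/-! ### Coefficients of directional derivatives and of the Laplacian -/

namespace NCPoly

variable {ι : Type}

/-- This is the substitution at `t = 0`; it supplies the undifferentiated factors in the Leibniz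
rule. -/
theorem coeff_zero_shift [DecidableEq ι] (i : ι) (p : WithDir ι) : (shift i p).coeff 0 = p := by
  induction p using FreeAlgebra.induction with
  | grade0 r =>
    rw [AlgHom.commutes, Polynomial.algebraMap_apply, Polynomial.coeff_C_zero]
  | grade1 v =>
    rw [shift, lift_ι_apply]
    split_ifs <;> simp
  | mul a b ha hb => rw [map_mul, Polynomial.mul_coeff_zero, ha, hb]
  | add a b ha hb => rw [map_add, Polynomial.coeff_add, ha, hb]

@[simp]
theorem dirDeriv_add [DecidableEq ι] (i : ι) (p q : WithDir ι) :
    dirDeriv i (p + q) = dirDeriv i p + dirDeriv i q := by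
  simp [dirDeriv]

@[simp]
theorem dirDeriv_smul [DecidableEq ι] (i : ι) (r : ℝ) (p : WithDir ι) :
    dirDeriv i (r • p) = r • dirDeriv i p := by
  simp [dirDeriv, ← Polynomial.coeff_zero_eq_eval_zero]

@[simp]
theorem dirDeriv_zero [DecidableEq ι] (i : ι) : dirDeriv i (0 : WithDir ι) = 0 := by
  simp [dirDeriv]

@[simp]
theorem dirDeriv_one [DecidableEq ι] (i : ι) : dirDeriv i (1 : WithDir ι) = 0 := by
  simp [dirDeriv]

theorem dirDeriv_mul [DecidableEq ι] (i : ι) (p q : WithDir ι) :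
    dirDeriv i (p * q) = dirDeriv i p * q + p * dirDeriv i q := by
  simp only [dirDeriv, map_mul, Polynomial.derivative_mul, ← Polynomial.coeff_zero_eq_eval_zero,
    Polynomial.coeff_add, Polynomial.mul_coeff_zero, coeff_zero_shift]

theorem dirDeriv_ι [DecidableEq ι] (i : ι) (v : Option ι) :
    dirDeriv i (FreeAlgebra.ι ℝ v) = if v = some i then dirVar ι else 0 := by
  rw [dirDeriv, shift, lift_ι_apply]
  split_ifs <;> simp

theorem dirDeriv_algebraMap [DecidableEq ι] (i : ι) (r : ℝ) :
    dirDeriv i (algebraMap ℝ (WithDir ι) r) = 0 := by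
  rw [Algebra.algebraMap_eq_smul_one, dirDeriv_smul, dirDeriv_one, smul_zero]

theorem star_dirDeriv [DecidableEq ι] (i : ι) (p : WithDir ι) : star (dirDeriv i p) = dirDeriv i
    (star p) := by
  induction p using FreeAlgebra.induction with
  | grade0 r => rw [star_algebraMap, dirDeriv_algebraMap, star_zero]
  | grade1 v => rw [star_ι, dirDeriv_ι]; split_ifs <;> simp [dirVar]
  | mul a b ha hb =>
    rw [dirDeriv_mul, star_add, star_mul, star_mul, ha, hb, star_mul, dirDeriv_mul, add_comm]
  | add a b ha hb => rw [dirDeriv_add, star_add, ha, hb, star_add, dirDeriv_add]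

theorem star_incl (p : NCPoly ι) : star (incl p) = incl (star p) := by
  induction p using FreeAlgebra.induction with
  | grade0 r => simp
  | grade1 v => simp [incl]
  | mul a b ha hb => rw [map_mul, star_mul, ha, hb, star_mul, map_mul]
  | add a b ha hb => rw [map_add, star_add, ha, hb, star_add, map_add]

theorem incl_word (l : List ι) : incl (word ℝ l) = word ℝ (l.map some) := by
  induction l with
  | nil => simp
  | cons v l ih => rw [word_cons, map_mul, ih, List.map_cons, word_cons]; simp [incl]

theorem coeff_incl (l : List ι) (p : NCPoly ι) : coeff (l.map some) (incl p) = coeff l p := by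
  classical
  induction p using induction_word with
  | hw m =>
    rw [incl_word, coeff_word, coeff_word]
    simp only [(List.map_injective_iff.mpr (Option.some_injective ι)).eq_iff]
  | h0 => simp
  | hadd p q hp hq => rw [map_add, map_add, map_add, hp, hq]
  | hsmul r p hp => rw [map_smul, map_smul, map_smul, hp]

theorem coeff_incl_of_mem [DecidableEq ι] {l : List (Option ι)} (hl : l.count none ≠ 0)
    (p : NCPoly ι) :
    coeff l (incl p) = 0 := by
  induction p using induction_word with
  | hw m =>
    rw [incl_word, coeff_word, if_neg]
    rintro rfl
    exact hl (by simp [List.count_eq_zero])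
  | h0 => simp
  | hadd p q hp hq => rw [map_add, map_add, hp, hq, add_zero]
  | hsmul r p hp => rw [map_smul, map_smul, hp, smul_zero]

/-- The effect of the directional derivative on coefficient functions: sum over the occurrences of
`h` in a word of the coefficient of the word with `x i` in that place. -/
def derivCoeff (i : ι) : (List (Option ι) → ℝ) → List (Option ι) → ℝ
  | _, [] => 0
  | c, v :: l => (if v = none then c (some i :: l) else 0) + derivCoeff i (fun m => c (v :: m)) l

theorem derivCoeff_add (i : ι) (l : List (Option ι)) (c c' : List (Option ι) → ℝ) :
    derivCoeff i (fun m => c m + c' m) l = derivCoeff i c l + derivCoeff i c' l := by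
  induction l generalizing c c' with
  | nil => simp [derivCoeff]
  | cons v l ih =>
    rw [derivCoeff, derivCoeff, derivCoeff, ih]
    split_ifs <;> ring

theorem derivCoeff_smul (i : ι) (l : List (Option ι)) (r : ℝ) (c : List (Option ι) → ℝ) :
    derivCoeff i (fun m => r * c m) l = r * derivCoeff i c l := by
  induction l generalizing c with
  | nil => simp [derivCoeff]
  | cons v l ih =>
    rw [derivCoeff, derivCoeff, ih]
    split_ifs <;> ring

theorem derivCoeff_zero (i : ι) (l : List (Option ι)) : derivCoeff i (fun _ => 0) l = 0 := by
  simpa using derivCoeff_smul i l 0 (fun _ => 0)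

/-- The recursion defining `derivCoeff` mirrors the Leibniz rule for a letter times a word: either
the first letter is differentiated, or the remaining word is. -/
theorem coeff_dirDeriv [DecidableEq ι] (i : ι) (p : WithDir ι) (l : List (Option ι)) :
    coeff l (dirDeriv i p) = derivCoeff i (fun m => coeff m p) l := by
  induction p using induction_word with
  | hw m =>
    induction m generalizing l with
    | nil =>
      rw [word_nil, dirDeriv_one, map_zero]
      have h1 : ∀ m : List (Option ι), coeff m (1 : WithDir ι) = if m = [] then 1 else 0 := by
        intro m
        rw [← word_nil, coeff_word]
        simp only [eq_comm]
      cases l with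
      | nil => rfl
      | cons v l => simp [derivCoeff, h1, derivCoeff_zero]
    | cons u m ih =>
      rw [word_cons, dirDeriv_mul, dirDeriv_ι, map_add]
      cases l with
      | nil =>
        rw [coeff_nil_ι_mul, derivCoeff]
        split_ifs
        · rw [dirVar, coeff_nil_ι_mul, add_zero]
        · simp
      | cons v l =>
        rw [derivCoeff]
        simp only [coeff_cons_ι_mul]
        have h2 : derivCoeff i (fun n => if u = v then coeff n (word ℝ m) else 0) l =
            if u = v then coeff l (dirDeriv i (word ℝ m)) else 0 := by
          split_ifs
          · exact (ih l).symm
          · exact derivCoeff_zero i l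
        rw [h2]
        congr 1
        by_cases hu : u = some i
        · simp only [hu, if_true, dirVar, coeff_cons_ι_mul, eq_comm]
        · simp [hu]
  | h0 => simp [derivCoeff_zero]
  | hadd p q hp hq => rw [dirDeriv_add, map_add, hp, hq, ← derivCoeff_add]; simp only [map_add]
  | hsmul r p hp =>
    rw [dirDeriv_smul, map_smul, hp, smul_eq_mul, ← derivCoeff_smul]
    simp only [map_smul, smul_eq_mul]

theorem derivCoeff_map_some (i : ι) (b : List ι) (c : List (Option ι) → ℝ) :
    derivCoeff i c (b.map some) = 0 := by
  induction b generalizing c with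
  | nil => rfl
  | cons v b ih => rw [List.map_cons, derivCoeff, ih]; simp

theorem derivCoeff_append (i : ι) (a : List ι) (l : List (Option ι)) (c : List (Option ι) → ℝ) :
    derivCoeff i c (a.map some ++ l) = derivCoeff i (fun m => c (a.map some ++ m)) l := by
  induction a generalizing c with
  | nil => rfl
  | cons v a ih => rw [List.map_cons, List.cons_append, derivCoeff, ih]; simp

theorem derivCoeff_one (i : ι) (a b : List ι) (c : List (Option ι) → ℝ) :
    derivCoeff i c (a.map some ++ none :: b.map some) = c ((a ++ i :: b).map some) := by
  rw [derivCoeff_append, derivCoeff, derivCoeff_map_some]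
  simp

theorem derivCoeff_two (i : ι) (a m b : List ι) (c : List (Option ι) → ℝ) :
    derivCoeff i c (a.map some ++ none :: (m.map some ++ none :: b.map some)) =
      c ((a ++ i :: m).map some ++ none :: b.map some) +
        c (a.map some ++ none :: ((m ++ i :: b).map some)) := by
  rw [derivCoeff_append, derivCoeff, derivCoeff_one]
  simp

theorem derivCoeff_eq_zero_of_length (i : ι) {c : List (Option ι) → ℝ} {l : List (Option ι)}
    (hc : ∀ m : List (Option ι), m.length = l.length → c m = 0) : derivCoeff i c l = 0 := by
  induction l generalizing c with
  | nil => rfl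
  | cons v l ih =>
    rw [derivCoeff, hc _ (by simp), ih fun m hm => hc _ (by simp [hm])]
    simp

/-- Each derivative turns one letter `x i` into `h`, so support on words with `n` letters `h` moves
to support on words with `n + 1` of them. -/
theorem derivCoeff_eq_zero [DecidableEq ι] (i : ι) {n : ℕ} {c : List (Option ι) → ℝ} {l : List
    (Option ι)}
    (hc : ∀ m : List (Option ι), m.length = l.length → m.count none ≠ n → c m = 0)
    (hl : l.count none ≠ n + 1) : derivCoeff i c l = 0 := by
  induction l generalizing c n with
  | nil => rfl
  | cons v l ih =>
    rw [derivCoeff]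
    cases v with
    | none =>
      rw [if_pos rfl, hc _ (by simp) (by simpa using hl), zero_add]
      rcases n with _ | n
      -- For `n = 0` a word that starts with `h` is already outside the support, so the slice
      -- vanishes at every word of this length and there is no smaller `n` to induct on.
      · exact derivCoeff_eq_zero_of_length i fun m hm => hc _ (by simp [hm]) (by simp)
      · refine ih (n := n) (fun m hm hm' => hc _ (by simp [hm]) (by simpa using hm')) ?_
        simpa using hl
    | some j =>
      rw [if_neg (by simp), zero_add]
      exact ih (fun m hm hm' => hc _ (by simp [hm]) (by simpa using hm')) (by simpa using hl)

theorem exists_eq_map_some {l : List (Option ι)} (h : none ∉ l) : ∃ a : List ι, l = a.map some := by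
  induction l with
  | nil => exact ⟨[], rfl⟩
  | cons v l ih =>
    simp only [List.mem_cons, not_or] at h
    obtain ⟨a, rfl⟩ := ih h.2
    obtain ⟨j, rfl⟩ := Option.ne_none_iff_exists'.mp (Ne.symm h.1)
    exact ⟨j :: a, rfl⟩

theorem exists_eq_append_of_count [DecidableEq ι] {l : List (Option ι)} {n : ℕ}
    (h : l.count none = n + 1) :
    ∃ (a : List ι) (m : List (Option ι)), l = a.map some ++ none :: m ∧ m.count none = n := by
  induction l with
  | nil => simp at h
  | cons v l ih =>
    cases v with
    | none => exact ⟨[], l, rfl, by simpa using h⟩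
    | some j =>
      obtain ⟨a, m, rfl, hm⟩ := ih (by simpa using h)
      exact ⟨j :: a, m, rfl, hm⟩

theorem exists_eq_of_count_two [DecidableEq ι] {l : List (Option ι)} (h : l.count none = 2) :
    ∃ a m b : List ι, l = a.map some ++ none :: (m.map some ++ none :: b.map some) := by
  obtain ⟨a, l', rfl, h'⟩ := exists_eq_append_of_count h
  obtain ⟨m, l'', rfl, h''⟩ := exists_eq_append_of_count h'
  obtain ⟨b, rfl⟩ := exists_eq_map_some (List.count_eq_zero.mp h'')
  exact ⟨a, m, b, rfl⟩

theorem lap_add [Fintype ι] [DecidableEq ι] (p q : NCPoly ι) : lap (p + q) = lap p + lap q := by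
  simp [lap, Finset.sum_add_distrib]

theorem lap_smul [Fintype ι] [DecidableEq ι] (r : ℝ) (p : NCPoly ι) : lap (r • p) = r • lap p := by
  simp [lap, Finset.smul_sum]

theorem lap_neg [Fintype ι] [DecidableEq ι] (p : NCPoly ι) : lap (-p) = -lap p := by
  rw [← neg_one_smul ℝ, lap_smul, neg_one_smul]

theorem lap_sub [Fintype ι] [DecidableEq ι] (p q : NCPoly ι) : lap (p - q) = lap p - lap q := by
  rw [sub_eq_add_neg, lap_add, lap_neg, sub_eq_add_neg]

theorem star_lap [Fintype ι] [DecidableEq ι] (p : NCPoly ι) : star (lap p) = lap (star p) := by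
  simp only [lap, star_sum, star_dirDeriv, star_incl]

/-- The two letters `h` may arise in either order, and both orders come from the same word `a x_i m
x_i b`; hence the factor 2. -/
theorem coeff_lap [Fintype ι] [DecidableEq ι] (a m b : List ι) (p : NCPoly ι) :
    coeff (a.map some ++ none :: (m.map some ++ none :: b.map some)) (lap p) =
      2 * ∑ i, coeff (a ++ i :: (m ++ i :: b)) p := by
  rw [lap, map_sum, Finset.mul_sum]
  refine Finset.sum_congr rfl fun i _ => ?_
  rw [coeff_dirDeriv, derivCoeff_two, coeff_dirDeriv, coeff_dirDeriv, derivCoeff_one,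
    derivCoeff_one, coeff_incl, coeff_incl, List.append_assoc, List.cons_append, two_mul]

theorem coeff_lap_eq_zero [Fintype ι] [DecidableEq ι] {l : List (Option ι)}
    (hl : l.count none ≠ 2) (p : NCPoly ι) :
    coeff l (lap p) = 0 := by
  rw [lap, map_sum]
  refine Finset.sum_eq_zero fun i _ => ?_
  rw [coeff_dirDeriv]
  refine derivCoeff_eq_zero i (n := 1) (fun m _ hm => ?_) hl
  rw [coeff_dirDeriv]
  exact derivCoeff_eq_zero i (n := 0) (fun m _ hm => coeff_incl_of_mem hm p) hm

theorem lap_mem_homogeneous [Fintype ι] [DecidableEq ι] {d : ℕ} {p : NCPoly ι}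
    (hp : p ∈ homogeneous ι d) :
    lap p ∈ homogeneous (Option ι) d := by
  rw [mem_homogeneous_iff]
  intro l hl
  by_cases h : l.count none = 2
  · obtain ⟨a, m, b, rfl⟩ := exists_eq_of_count_two h
    rw [coeff_lap, Finset.sum_eq_zero, mul_zero]
    intro i _
    refine coeff_eq_zero_of_mem_homogeneous hp ?_
    simpa using hl
  · exact coeff_lap_eq_zero h p

theorem isHarmonic_iff [Fintype ι] [DecidableEq ι] {p : NCPoly ι} :
    IsHarmonic p ↔ ∀ a m b : List ι, ∑ i, coeff (a ++ i :: (m ++ i :: b)) p = 0 := by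
  constructor
  · intro h a m b
    have := coeff_lap a m b p
    rw [h, map_zero] at this
    linarith
  · intro h
    refine coeff_injective fun l => ?_
    rw [map_zero]
    by_cases hl : l.count none = 2
    · obtain ⟨a, m, b, rfl⟩ := exists_eq_of_count_two hl
      rw [coeff_lap, h, mul_zero]
    · exact coeff_lap_eq_zero hl p

end NCPoly

/-! ### Matrix positivity tested on labelled paths -/

theorem Matrix.PosSemidef.apply_eq_zero {n : Type*} [Fintype n] {A : Matrix n n ℝ}
    (hA : A.PosSemidef) {i : n} (hi : A i i = 0) (j : n) : A i j = 0 := by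
  classical
  -- An isotropic vector of a positive semidefinite form lies in its kernel; here the vector is the
  -- `i`-th basis vector.
  have h := (Matrix.PosSemidef.dotProduct_mulVec_zero_iff hA (Pi.single i 1)).mp (by simp [hi])
  have h' := congrFun h j
  rw [Matrix.mulVec_single_one] at h'
  have h2 := hA.isHermitian.apply j i
  simp only [Matrix.col_apply, Pi.zero_apply] at h'
  rw [← h2] at h'
  simpa using h'

namespace NCPoly

variable {ι : Type}

theorem evalMat_word {n : ℕ} (X : ι → Matrix (Fin n) (Fin n) ℝ) (l : List ι) :
    evalMat X (word ℝ l) = (l.map X).prod := by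
  induction l with
  | nil => simp [evalMat]
  | cons v l ih =>
    rw [evalMat] at ih
    rw [word_cons, evalMat, map_mul, ih, lift_ι_apply, List.map_cons, List.prod_cons]

/-- The adjacency matrices of the edges of a path whose `k`-th edge carries the `k`-th letter of
`w`: the matrix of `v` collects the edges with the letter `v`. -/
def pathMat [DecidableEq ι] (w : List ι) (v : ι) :
    Matrix (Fin (w.length + 1)) (Fin (w.length + 1)) ℝ :=
  Matrix.of fun i j => if (j.1 = i.1 + 1 ∧ w[i.1]? = some v) ∨ (i.1 = j.1 + 1 ∧ w[j.1]? = some v)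
    then 1 else 0

theorem pathMat_isSymm [DecidableEq ι] (w : List ι) (v : ι) : (pathMat w v).IsSymm := by
  ext i j
  simp only [Matrix.transpose_apply, pathMat, Matrix.of_apply, or_comm]

theorem of_pathMat_ne_zero [DecidableEq ι] {w : List ι} {v : ι} {i j : Fin (w.length + 1)}
    (h : pathMat w v i j ≠ 0) :
    (j.1 = i.1 + 1 ∧ w[i.1]? = some v) ∨ (i.1 = j.1 + 1 ∧ w[j.1]? = some v) := by
  by_contra hn
  exact h (if_neg hn)

theorem exists_of_prod_cons_ne_zero {n : ℕ} {X : ι → Matrix (Fin n) (Fin n) ℝ} {v : ι}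
    {u : List ι} {i j : Fin n} (h : ((v :: u).map X).prod i j ≠ 0) :
    ∃ k, X v i k ≠ 0 ∧ (u.map X).prod k j ≠ 0 := by
  rw [List.map_cons, List.prod_cons, Matrix.mul_apply] at h
  obtain ⟨k, -, hk⟩ := Finset.exists_ne_zero_of_sum_ne_zero h
  exact ⟨k, left_ne_zero_of_mul hk, right_ne_zero_of_mul hk⟩

/-- A nonzero entry comes from a walk from `i` to `j` spelling `u`. Each step moves by exactly one
vertex, which bounds the distance and fixes the parity. -/
theorem of_prod_pathMat_ne_zero [DecidableEq ι] {w u : List ι} {i j : Fin (w.length + 1)}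
    (h : (u.map (pathMat w)).prod i j ≠ 0) :
    i.1 ≤ j.1 + u.length ∧ j.1 ≤ i.1 + u.length ∧ (i.1 + j.1 + u.length) % 2 = 0 := by
  induction u generalizing i with
  | nil =>
    have : i = j := by
      by_contra hij
      exact h (by simp [hij])
    subst this
    simp only [List.length_nil]
    omega
  | cons v u ih =>
    obtain ⟨k, hk, hk'⟩ := exists_of_prod_cons_ne_zero h
    have h1 := of_pathMat_ne_zero hk
    have h2 := ih hk'
    simp only [List.length_cons]
    omega

/-- The number of steps equals the distance to the last vertex, so only the walk that never turns
back contributes, and it spells the rest of `w`. -/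
theorem prod_pathMat_straight [DecidableEq ι] (u a t : List ι) (w : List ι) (hw : w = a ++ t)
    (ht : t.length = u.length) (i : Fin (w.length + 1)) (hi : i.1 = a.length) :
    (u.map (pathMat w)).prod i (Fin.last _) = if u = t then 1 else 0 := by
  induction u generalizing a t i with
  | nil =>
    obtain rfl : t = [] := List.length_eq_zero_iff.mp ht
    have : i = Fin.last _ := by
      ext
      simp [hi, hw]
    simp [this]
  | cons v u ih =>
    rcases t with _ | ⟨x, t⟩
    · simp at ht
    have hlen : w.length = a.length + (t.length + 1) := by rw [hw]; simp
    have ht' : t.length = u.length := by simpa using ht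
    rw [List.map_cons, List.prod_cons, Matrix.mul_apply]
    have hx : w[i.1]? = some x := by rw [hi, hw]; simp
    rw [Finset.sum_eq_single (⟨a.length + 1, by omega⟩ : Fin (w.length + 1))]
    · rw [ih (a ++ [x]) t (by simp [hw]) ht' _ (by simp)]
      have : pathMat w v i ⟨a.length + 1, by omega⟩ = if v = x then 1 else 0 := by
        simp only [pathMat, Matrix.of_apply, hx]
        refine if_congr ?_ rfl rfl
        have h1 : ¬ a.length = a.length + 1 + 1 := by omega
        simp [hi, h1, eq_comm (a := v)]
      rw [this]
      by_cases hvx : v = x <;> simp [hvx]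
    · intro k _ hk
      by_contra hne
      have h1 := of_pathMat_ne_zero (left_ne_zero_of_mul hne)
      have h2 := of_prod_pathMat_ne_zero (right_ne_zero_of_mul hne)
      have h3 : k.1 ≠ a.length + 1 := fun h => hk (Fin.ext h)
      simp only [Fin.val_last] at h2
      omega
    · simp

/-- Edge `k` joins the vertices `k` and `k + 1`, so a walk using an edge labelled `v₀` visits vertex
`d + 1`. It needs at least `d + 1 - i` steps to get there and `d + 1` steps to come back to `0`. -/
theorem length_of_mem_of_prod_ne_zero [DecidableEq ι] {w u : List ι} {d : ℕ} {v₀ : ι}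
    (hw : ∀ k, w[k]? = some v₀ → d ≤ k) (hu : v₀ ∈ u) {i : Fin (w.length + 1)}
    (h : (u.map (pathMat w)).prod i 0 ≠ 0) : 2 * (d + 1) ≤ u.length + i.1 := by
  induction u generalizing i with
  | nil => simp at hu
  | cons v u ih =>
    obtain ⟨k, hk, hk'⟩ := exists_of_prod_cons_ne_zero h
    have h1 := of_pathMat_ne_zero hk
    have h2 := (of_prod_pathMat_ne_zero hk').1
    simp only [Fin.val_zero, zero_add] at h2
    rw [List.length_cons]
    rcases List.mem_cons.mp hu with rfl | hu
    · rcases h1 with ⟨h1, h3⟩ | ⟨h1, h3⟩ <;> have := hw _ h3 <;> omega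
    · have := ih hu hk'
      omega

theorem evalMat_pathMat_straight [DecidableEq ι] {w : List ι} {q : NCPoly ι}
    (hq : q ∈ homogeneous ι w.length) :
    evalMat (pathMat w) q 0 (Fin.last _) = coeff w q := by
  refine homogeneous_induction
    (P := fun q => evalMat (pathMat w) q 0 (Fin.last _) = coeff w q) ?_ ?_ ?_ ?_ hq
  · intro l hl
    rw [evalMat_word, prod_pathMat_straight l [] w w rfl hl.symm 0 rfl, coeff_word]
  · simp [evalMat]
  · intro p q hp hq
    rw [evalMat] at hp hq ⊢
    rw [map_add, map_add, Matrix.add_apply, hp, hq]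
  · intro r p hp
    rw [evalMat] at hp ⊢
    rw [map_smul, map_smul, Matrix.smul_apply, hp]

theorem evalMat_apply_eq_zero {n d : ℕ} {X : ι → Matrix (Fin n) (Fin n) ℝ} {i j : Fin n}
    {q : NCPoly ι} (hq : q ∈ homogeneous ι d)
    (h : ∀ l : List ι, l.length = d → coeff l q ≠ 0 → (l.map X).prod i j = 0) :
    evalMat X q i j = 0 := by
  obtain ⟨s, -, hs⟩ := eq_sum_coeff_smul_word q
  rw [hs, evalMat, map_sum, Matrix.sum_apply]
  refine Finset.sum_eq_zero fun l _ => ?_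
  rw [map_smul, Matrix.smul_apply, ← evalMat, evalMat_word]
  by_cases hc : coeff l q = 0
  · rw [hc, zero_smul]
  · by_cases hl : l.length = d
    · rw [h l hl hc, smul_zero]
    · exact absurd (coeff_eq_zero_of_mem_homogeneous hq hl) hc

/-- The hypothesis makes the corner diagonal entry zero, which forces the whole first row to vanish;
its last entry is the coefficient of `w`. -/
theorem IsMatrixPositive.coeff_eq_zero [DecidableEq ι] {q : NCPoly ι}
    (hpos : IsMatrixPositive q) {w : List ι}
    (hq : q ∈ homogeneous ι w.length)
    (h : ∀ l : List ι, l.length = w.length → coeff l q ≠ 0 →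
      (l.map (pathMat w)).prod 0 0 = 0) :
    coeff w q = 0 := by
  rw [← evalMat_pathMat_straight hq]
  exact (hpos.2 _ _ (pathMat_isSymm w)).apply_eq_zero (evalMat_apply_eq_zero hq h) _

/-- A matrix positive homogeneous polynomial of odd degree is zero. -/
theorem IsMatrixPositive.eq_zero_of_odd [DecidableEq ι] {d : ℕ} (hd : Odd d) {q : NCPoly ι}
    (hpos : IsMatrixPositive q) (hq : q ∈ homogeneous ι d) : q = 0 := by
  refine eq_of_coeff_eq hq (zero_mem _) fun w hw => ?_
  subst hw
  rw [map_zero]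
  -- A closed walk on a path has even length.
  refine hpos.coeff_eq_zero hq fun l hl _ => ?_
  by_contra hne
  have := (of_prod_pathMat_ne_zero hne).2.2
  rw [hl] at this
  obtain ⟨k, hk⟩ := hd
  simp only [Fin.val_zero] at this
  omega

/-- Words of length `2 d` starting with `d` letters other than `v₀` do not occur in a matrix
positive polynomial all of whose words contain `v₀`. -/
theorem IsMatrixPositive.coeff_append_eq_zero [DecidableEq ι] {d : ℕ} {v₀ : ι} {q : NCPoly ι}
    (hpos : IsMatrixPositive q) (hq : q ∈ homogeneous ι (2 * d))
    (hv : ∀ l, v₀ ∉ l → coeff l q = 0) {a b : List ι} (ha : v₀ ∉ a) (hd : d ≤ a.length)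
    (hab : (a ++ b).length = 2 * d) : coeff (a ++ b) q = 0 := by
  refine hpos.coeff_eq_zero (hab ▸ hq) fun l hl hc => ?_
  by_contra hne
  have hmem : v₀ ∈ l := by
    by_contra hn
    exact hc (hv l hn)
  -- The edges labelled `v₀` have index at least `d`, so a closed walk through one of them takes at
  -- least `2 * d + 2` steps, while `l` has only `2 * d` letters.
  have := length_of_mem_of_prod_ne_zero (d := d) ?_ hmem hne
  · simp only [Fin.val_zero] at this
    omega
  · intro k hk
    by_contra hlt
    rw [List.getElem?_append_left (by omega)] at hk
    exact ha (List.mem_of_getElem? hk)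

theorem IsSubharmonic.sum_coeff_eq_zero_right [Fintype ι] [DecidableEq ι] {d : ℕ} {p : NCPoly ι}
    (hs : IsSubharmonic p)
    (hp : p ∈ homogeneous ι (2 * d)) {a m b : List ι} (hd : d ≤ a.length)
    (hl : a.length + m.length + b.length + 2 = 2 * d) :
    ∑ i, coeff (a ++ i :: (m ++ i :: b)) p = 0 := by
  have h := hs.coeff_append_eq_zero (d := d) (v₀ := none) (lap_mem_homogeneous hp)
    (fun l hl => coeff_lap_eq_zero (by rw [List.count_eq_zero_of_not_mem hl]; simp) p)
    (a := a.map some) (b := none :: (m.map some ++ none :: b.map some)) (by simp) (by simpa)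
    (by simp; omega)
  rw [coeff_lap] at h
  linarith

theorem IsSubharmonic.sum_coeff_eq_zero_left [Fintype ι] [DecidableEq ι] {d : ℕ} {p : NCPoly ι}
    (hs : IsSubharmonic p)
    (hp : p ∈ homogeneous ι (2 * d)) {a m b : List ι} (hd : d ≤ b.length)
    (hl : a.length + m.length + b.length + 2 = 2 * d) :
    ∑ i, coeff (a ++ i :: (m ++ i :: b)) p = 0 := by
  have h1 := coeff_lap a m b p
  -- The reversal is applied to words of `lap p`, whose symmetry is part of matrix positivity; `p`
  -- itself need not be symmetric here.
  rw [← isSymm_iff_coeff.mp hs.1] at h1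
  have h2 := coeff_lap b.reverse m.reverse a.reverse p
  rw [hs.sum_coeff_eq_zero_right hp (by simpa) (by simp; omega)] at h2
  simp only [List.reverse_append, List.reverse_cons, ← List.map_reverse, List.append_assoc,
    List.cons_append, List.nil_append] at h1
  rw [h1] at h2
  linarith

theorem not_isPurelySubharmonic_of_odd [Fintype ι] [DecidableEq ι] {d : ℕ} (hd : Odd d)
    {p : NCPoly ι}
    (hp : p ∈ homogeneous ι d) : ¬ IsPurelySubharmonic p := fun h =>
  h.2 (h.1.eq_zero_of_odd hd (lap_mem_homogeneous hp))

end NCPoly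

/-! ### Powers of `γ` and the harmonic polynomials -/

namespace NCPoly

theorem coeff_gamma_pow (d : ℕ) (l : List (Fin 2)) :
    coeff l (gamma ^ d) = if l.length = d then Complex.I ^ l.count 1 else 0 := by
  induction d generalizing l with
  | zero =>
    rw [pow_zero, ← word_nil, coeff_word]
    cases l <;> simp
  | succ d ih =>
    rw [pow_succ', gamma, add_mul, smul_mul_assoc, map_add, map_smul, ← gamma]
    rcases l with _ | ⟨v, l⟩
    · simp [coeff_nil_ι_mul]
    · rw [coeff_cons_ι_mul, coeff_cons_ι_mul, ih]
      fin_cases v <;> simp [pow_succ']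

theorem coeff_re_gamma_pow (d : ℕ) (l : List (Fin 2)) :
    coeff l (re (gamma ^ d)) = if l.length = d then (Complex.I ^ l.count 1).re else 0 := by
  rw [re, coeff_mapCoeff, coeff_gamma_pow]
  split_ifs <;> simp

theorem coeff_im_gamma_pow (d : ℕ) (l : List (Fin 2)) :
    coeff l (im (gamma ^ d)) = if l.length = d then (Complex.I ^ l.count 1).im else 0 := by
  rw [im, coeff_mapCoeff, coeff_gamma_pow]
  split_ifs <;> simp

theorem re_gamma_pow_mem_homogeneous (d : ℕ) : re (gamma ^ d) ∈ homogeneous (Fin 2) d :=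
  mem_homogeneous_iff.mpr fun l hl => by rw [coeff_re_gamma_pow, if_neg hl]

theorem im_gamma_pow_mem_homogeneous (d : ℕ) : im (gamma ^ d) ∈ homogeneous (Fin 2) d :=
  mem_homogeneous_iff.mpr fun l hl => by rw [coeff_im_gamma_pow, if_neg hl]

theorem isSymm_re_gamma_pow (d : ℕ) : IsSymm (re (gamma ^ d)) :=
  isSymm_iff_coeff.mpr fun l => by
    rw [coeff_re_gamma_pow, coeff_re_gamma_pow, List.length_reverse, List.count_reverse]

theorem isSymm_im_gamma_pow (d : ℕ) : IsSymm (im (gamma ^ d)) :=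
  isSymm_iff_coeff.mpr fun l => by
    rw [coeff_im_gamma_pow, coeff_im_gamma_pow, List.length_reverse, List.count_reverse]

theorem IsSymm.sq {ι : Type} {p : NCPoly ι} (hp : IsSymm p) : IsSymm (p ^ 2) := by
  rw [IsSymm] at *
  rw [star_pow, hp]

/-- Replacing a pair of letters `x₁` by a pair of letters `x₂` multiplies the coefficient in `γ^d`
by `I ^ 2 = -1`, so every contraction cancels. The imaginary part works the same way. -/
theorem isHarmonic_re_gamma_pow (d : ℕ) : IsHarmonic (re (gamma ^ d)) := by
  rw [isHarmonic_iff]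
  intro a m b
  rw [Fin.sum_univ_two, coeff_re_gamma_pow, coeff_re_gamma_pow]
  simp only [List.length_append, List.length_cons, List.count_append, List.count_cons]
  split_ifs <;> simp_all [pow_add, mul_assoc]

theorem isHarmonic_im_gamma_pow (d : ℕ) : IsHarmonic (im (gamma ^ d)) := by
  rw [isHarmonic_iff]
  intro a m b
  rw [Fin.sum_univ_two, coeff_im_gamma_pow, coeff_im_gamma_pow]
  simp only [List.length_append, List.length_cons, List.count_append, List.count_cons]
  split_ifs <;> simp_all [pow_add, mul_assoc]

theorem IsHarmonic.add {p q : NCPoly (Fin 2)} (hp : IsHarmonic p) (hq : IsHarmonic q) :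
    IsHarmonic (p + q) := by
  rw [IsHarmonic, lap_add, hp, hq, add_zero]

theorem IsHarmonic.smul {p : NCPoly (Fin 2)} (hp : IsHarmonic p) (r : ℝ) :
    IsHarmonic (r • p) := by
  rw [IsHarmonic, lap_smul, hp, smul_zero]

/-- A function on the words of length at least three all of whose contractions vanish is
determined by two of its values. -/
theorem eq_of_contraction_eq_zero (n : ℕ) (c : List (Fin 2) → ℝ)
    (h : ∀ a m b : List (Fin 2), a.length + m.length + b.length = n + 1 →
      ∑ i, c (a ++ i :: (m ++ i :: b)) = 0) (w : List (Fin 2)) (hw : w.length = n + 3) :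
    c w = c (List.replicate (n + 3) 0) * (Complex.I ^ w.count 1).re +
      c (List.replicate (n + 2) 0 ++ [1]) * (Complex.I ^ w.count 1).im := by
  simp only [Fin.sum_univ_two] at h
  induction n generalizing c w with
  | zero =>
    obtain ⟨x, y, z, rfl⟩ := List.length_eq_three.mp hw
    have h1 := fun i => h [] [] [i] (by simp)
    have h2 := fun i => h [] [i] [] (by simp)
    have h3 := fun i => h [i] [] [] (by simp)
    have h10 := h1 0
    have h11 := h1 1
    have h20 := h2 0
    have h21 := h2 1
    have h30 := h3 0
    have h31 := h3 1
    simp only [List.nil_append, List.cons_append] at h10 h11 h20 h21 h30 h31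
    -- Three letters: six linear relations express the eight values through those at `000` and
    -- `001`.
    fin_cases x <;> fin_cases y <;> fin_cases z <;>
      simp [List.replicate, pow_succ] <;> linarith
  | succ n ih =>
    rcases w with _ | ⟨x, w⟩
    · simp at hw
    have hw' : w.length = n + 3 := by simpa using hw
    -- Fixing the first letter leaves a function with vanishing contractions. It remains to express
    -- its two free values through those of `c`, which is immediate for `x = 0`.
    rw [ih (fun l => c (x :: l)) w hw' fun a m b hl => h (x :: a) m b (by simp; omega)]
    -- For `x = 1`, `e1` relates `10…01` to `0…0`, with a sign. Both `e2` and `e3` contract to the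
    -- word `110…01`, and eliminating it relates `10…0` to `0…01`. Together they say that a leading
    -- letter 1 multiplies `I ^ k` by `I`.
    have e1 := h [] (List.replicate (n + 2) 0) [] (by simp)
    have e2 := h [1] (List.replicate (n + 1) 0) [] (by simp; omega)
    have e3 := h [] [] (List.replicate (n + 1) 0 ++ [1]) (by simp)
    rw [List.nil_append, List.nil_append, ← List.replicate_succ'] at e1
    rw [← List.replicate_succ', List.cons_append, List.nil_append, List.cons_append,
      List.nil_append, ← List.replicate_succ] at e2
    simp only [List.nil_append, ← List.cons_append, ← List.replicate_succ] at e3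
    have e4 : c (1 :: List.replicate (n + 3) 0) = c (List.replicate (n + 3) 0 ++ [1]) := by
      simp only [List.cons_append] at e2 e3 ⊢
      linarith
    fin_cases x
    · simp [List.replicate_succ]
    · rw [List.replicate_succ (n := n + 3)]
      simp only [Fin.mk_one, List.count_cons_self, pow_succ, e4]
      simp
      linear_combination (Complex.I ^ List.count 1 w).im * e1

theorem exists_eq_of_contraction_eq_zero {d : ℕ} (hd : 2 < d) (c : List (Fin 2) → ℝ)
    (h : ∀ a m b : List (Fin 2), a.length + m.length + b.length + 2 = d →
      ∑ i, c (a ++ i :: (m ++ i :: b)) = 0) (w : List (Fin 2)) (hw : w.length = d) :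
    c w = c (List.replicate d 0) * (Complex.I ^ w.count 1).re +
      c (List.replicate (d - 1) 0 ++ [1]) * (Complex.I ^ w.count 1).im := by
  obtain ⟨n, rfl⟩ : ∃ n, d = n + 3 := ⟨d - 3, by omega⟩
  exact eq_of_contraction_eq_zero n c (fun a m b hl => h a m b (by omega)) w hw

theorem isHarmonic_iff_exists {d : ℕ} (hd : 2 < d) (p : NCPoly (Fin 2)) :
    (p ∈ homogeneous (Fin 2) d ∧ IsHarmonic p) ↔
      ∃ a b : ℝ, p = a • re (gamma ^ d) + b • im (gamma ^ d) := by
  constructor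
  · rintro ⟨hp, hh⟩
    rw [isHarmonic_iff] at hh
    refine ⟨coeff (List.replicate d 0) p, coeff (List.replicate (d - 1) 0 ++ [1]) p, ?_⟩
    refine eq_of_coeff_eq hp (add_mem
      (Submodule.smul_mem _ _ (re_gamma_pow_mem_homogeneous d))
      (Submodule.smul_mem _ _ (im_gamma_pow_mem_homogeneous d))) fun l hl => ?_
    rw [exists_eq_of_contraction_eq_zero hd (fun w => coeff w p) (fun a m b _ => hh a m b) l hl,
      map_add, map_smul, map_smul, coeff_re_gamma_pow, coeff_im_gamma_pow, if_pos hl, if_pos hl,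
      smul_eq_mul, smul_eq_mul]
  · rintro ⟨a, b, rfl⟩
    exact ⟨add_mem (Submodule.smul_mem _ _ (re_gamma_pow_mem_homogeneous d))
      (Submodule.smul_mem _ _ (im_gamma_pow_mem_homogeneous d)),
      ((isHarmonic_re_gamma_pow d).smul a).add ((isHarmonic_im_gamma_pow d).smul b)⟩

theorem IsSymm.add {ι : Type} {p q : NCPoly ι} (hp : IsSymm p) (hq : IsSymm q) :
    IsSymm (p + q) := by
  rw [IsSymm] at *
  rw [star_add, hp, hq]

theorem IsSymm.smul {ι : Type} {p : NCPoly ι} (hp : IsSymm p) (r : ℝ) : IsSymm (r • p) := by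
  rw [IsSymm] at *
  rw [star_smul_real, hp]

/-- A polynomial of degree larger than two with symmetric Laplacian is symmetric. -/
theorem isSymm_of_isSymm_lap {d : ℕ} (hd : 2 < d) {p : NCPoly (Fin 2)}
    (hp : p ∈ homogeneous (Fin 2) d) (hs : IsSymm (lap p)) : IsSymm p := by
  have hstar : star p ∈ homogeneous (Fin 2) d := mem_homogeneous_iff.mpr fun l hl => by
    rw [coeff_star]
    exact coeff_eq_zero_of_mem_homogeneous hp (by simpa using hl)
  -- The antisymmetric difference `p - star p` is harmonic, hence a combination of the symmetric `Re
  -- γ^d` and `Im γ^d`; being both symmetric and antisymmetric, it is zero.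
  have hh : IsHarmonic (p - star p) := by
    rw [IsHarmonic, lap_sub, ← star_lap, hs, sub_self]
  obtain ⟨a, b, hab⟩ := (isHarmonic_iff_exists hd (p - star p)).mp ⟨sub_mem hp hstar, hh⟩
  have h2 : IsSymm (p - star p) := by
    rw [hab]
    exact ((isSymm_re_gamma_pow d).smul a).add ((isSymm_im_gamma_pow d).smul b)
  rw [IsSymm, star_sub, star_star] at h2
  refine coeff_injective fun l => ?_
  have := congrArg (coeff l) h2
  rw [map_sub, map_sub] at this
  linarith

/-! ### Matrix positive polynomials -/

theorem evalMat_star {ι : Type} {n : ℕ} {X : ι → Matrix (Fin n) (Fin n) ℝ}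
    (hX : ∀ i, (X i).IsSymm) (p : NCPoly ι) : evalMat X (star p) = (evalMat X p).conjTranspose := by
  rw [Matrix.conjTranspose_eq_transpose_of_trivial]
  unfold evalMat
  induction p using FreeAlgebra.induction with
  | grade0 r => simp [Matrix.algebraMap_eq_diagonal]
  | grade1 v => simpa using (hX v).symm
  | mul a b ha hb => rw [star_mul, map_mul, map_mul, Matrix.transpose_mul, ha, hb]
  | add a b ha hb => rw [star_add, map_add, map_add, Matrix.transpose_add, ha, hb]

theorem isMatrixPositive_star_mul_self {ι : Type} (p : NCPoly ι) :
    IsMatrixPositive (star p * p) := by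
  refine ⟨by rw [IsSymm, star_mul, star_star], fun n X hX => ?_⟩
  have h : evalMat X (star p * p) = (evalMat X p).conjTranspose * evalMat X p := by
    rw [← evalMat_star hX]
    exact map_mul _ _ _
  rw [h]
  exact Matrix.posSemidef_conjTranspose_mul_self _

theorem IsMatrixPositive.add {ι : Type} {p q : NCPoly ι} (hp : IsMatrixPositive p)
    (hq : IsMatrixPositive q) : IsMatrixPositive (p + q) := by
  refine ⟨hp.1.add hq.1, fun n X hX => ?_⟩
  have h : evalMat X (p + q) = evalMat X p + evalMat X q := map_add _ _ _
  rw [h]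
  exact (hp.2 n X hX).add (hq.2 n X hX)

theorem IsMatrixPositive.smul {ι : Type} {p : NCPoly ι} (hp : IsMatrixPositive p) {r : ℝ}
    (hr : 0 ≤ r) : IsMatrixPositive (r • p) := by
  refine ⟨hp.1.smul r, fun n X hX => ?_⟩
  have h : evalMat X (r • p) = r • evalMat X p := map_smul _ _ _
  rw [h]
  exact (hp.2 n X hX).smul hr

/-- Scalars are the 1 × 1 symmetric matrices. -/
theorem IsMatrixPositive.lift_nonneg {ι : Type} {p : NCPoly ι} (hp : IsMatrixPositive p)
    (x : ι → ℝ) : 0 ≤ FreeAlgebra.lift ℝ x p := by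
  have h := (hp.2 1 (fun i => algebraMap ℝ _ (x i)) fun i => by
    simp [Matrix.IsSymm, Matrix.algebraMap_eq_diagonal]).diag_nonneg (i := 0)
  have h2 : (FreeAlgebra.lift ℝ fun i => algebraMap ℝ (Matrix (Fin 1) (Fin 1) ℝ) (x i)) =
      (Algebra.ofId ℝ (Matrix (Fin 1) (Fin 1) ℝ)).comp (FreeAlgebra.lift ℝ x) := by
    ext i : 2
    simp
  rw [evalMat, h2] at h
  simpa [Algebra.ofId_apply, Matrix.algebraMap_eq_diagonal] using h

/-! ### Subharmonics of even degree -/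

theorem lap_mul (p q : NCPoly (Fin 2)) :
    lap (p * q) = lap p * incl q +
      (2 : ℝ) • (dirDeriv 0 (incl p) * dirDeriv 0 (incl q) +
        dirDeriv 1 (incl p) * dirDeriv 1 (incl q)) + incl p * lap q := by
  simp only [lap, Fin.sum_univ_two, map_mul, dirDeriv_mul, dirDeriv_add, add_mul, mul_add,
    two_smul]
  abel

theorem lap_sq_of_isHarmonic {p : NCPoly (Fin 2)} (hp : IsHarmonic p) :
    lap (p ^ 2) = (2 : ℝ) • (dirDeriv 0 (incl p) * dirDeriv 0 (incl p) +
        dirDeriv 1 (incl p) * dirDeriv 1 (incl p)) := by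
  rw [pow_two, lap_mul, hp, zero_mul, mul_zero, zero_add, add_zero]

/-- As `p` is harmonic, only the cross terms of the Leibniz rule survive in `lap (p ^ 2)`. They are
squares of the symmetric polynomials `dirDeriv i (incl p)`. -/
theorem isSubharmonic_sq {p : NCPoly (Fin 2)} (hs : IsSymm p) (hp : IsHarmonic p) :
    IsSubharmonic (p ^ 2) := by
  rw [IsSubharmonic, lap_sq_of_isHarmonic hp]
  have h : ∀ i, star (dirDeriv i (incl p)) = dirDeriv i (incl p) := fun i => by
    rw [star_dirDeriv, star_incl, hs]
  have h2 : ∀ i, IsMatrixPositive (dirDeriv i (incl p) * dirDeriv i (incl p)) := fun i => by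
    conv => arg 1; arg 1; rw [← h i]
    exact isMatrixPositive_star_mul_self _
  exact ((h2 0).add (h2 1)).smul two_pos.le

theorem re_gamma_pow_succ (d : ℕ) :
    re (gamma ^ (d + 1)) = x₁ * re (gamma ^ d) - x₂ * im (gamma ^ d) := by
  refine coeff_injective fun l => ?_
  rw [map_sub, x₁, x₂]
  rcases l with _ | ⟨v, l⟩
  · simp [coeff_nil_ι_mul, coeff_re_gamma_pow]
  · rw [coeff_cons_ι_mul, coeff_cons_ι_mul, coeff_re_gamma_pow, coeff_re_gamma_pow,
      coeff_im_gamma_pow]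
    fin_cases v
    · simp
    · simp [pow_succ]
      split_ifs <;> simp

theorem eq_of_coeff_append_eq {d : ℕ} {p q : NCPoly (Fin 2)}
    (hp : p ∈ homogeneous (Fin 2) (2 * d)) (hq : q ∈ homogeneous (Fin 2) (2 * d))
    (h : ∀ u v : List (Fin 2), u.length = d → v.length = d →
      coeff (u ++ v) p = coeff (u ++ v) q) : p = q := by
  refine eq_of_coeff_eq hp hq fun l hl => ?_
  rw [← List.take_append_drop d l]
  exact h _ _ (by simp; omega) (by simp; omega)

theorem sq_mem_homogeneous {d : ℕ} {p : NCPoly (Fin 2)} (hp : p ∈ homogeneous (Fin 2) d) :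
    p ^ 2 ∈ homogeneous (Fin 2) (2 * d) := by
  rw [pow_two, two_mul]
  exact mul_mem_homogeneous hp hp

theorem coeff_append_re_sq {d : ℕ} {u v : List (Fin 2)} (hu : u.length = d)
    (hv : v.length = d) : coeff (u ++ v) (re (gamma ^ d) ^ 2) =
    (Complex.I ^ u.count 1).re * (Complex.I ^ v.count 1).re := by
  rw [pow_two, coeff_append_mul (re_gamma_pow_mem_homogeneous d) _ _ hu, coeff_re_gamma_pow,
    coeff_re_gamma_pow, if_pos hu, if_pos hv]

theorem coeff_append_im_sq {d : ℕ} {u v : List (Fin 2)} (hu : u.length = d)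
    (hv : v.length = d) : coeff (u ++ v) (im (gamma ^ d) ^ 2) =
    (Complex.I ^ u.count 1).im * (Complex.I ^ v.count 1).im := by
  rw [pow_two, coeff_append_mul (im_gamma_pow_mem_homogeneous d) _ _ hu, coeff_im_gamma_pow,
    coeff_im_gamma_pow, if_pos hu, if_pos hv]

theorem coeff_append_re_two_mul {d : ℕ} {u v : List (Fin 2)} (hu : u.length = d)
    (hv : v.length = d) : coeff (u ++ v) (re (gamma ^ (2 * d))) =
    (Complex.I ^ u.count 1).re * (Complex.I ^ v.count 1).re -
      (Complex.I ^ u.count 1).im * (Complex.I ^ v.count 1).im := by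
  rw [coeff_re_gamma_pow, if_pos (by simp; omega), List.count_append, pow_add, Complex.mul_re]

theorem coeff_append_im_two_mul {d : ℕ} {u v : List (Fin 2)} (hu : u.length = d)
    (hv : v.length = d) : coeff (u ++ v) (im (gamma ^ (2 * d))) =
    (Complex.I ^ u.count 1).re * (Complex.I ^ v.count 1).im +
      (Complex.I ^ u.count 1).im * (Complex.I ^ v.count 1).re := by
  rw [coeff_im_gamma_pow, if_pos (by simp; omega), List.count_append, pow_add, Complex.mul_im]

theorem re_sq_eq (d : ℕ) :
    re (gamma ^ d) ^ 2 = im (gamma ^ d) ^ 2 + re (gamma ^ (2 * d)) := by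
  refine eq_of_coeff_append_eq (sq_mem_homogeneous (re_gamma_pow_mem_homogeneous d))
    (add_mem (sq_mem_homogeneous (im_gamma_pow_mem_homogeneous d))
      (re_gamma_pow_mem_homogeneous _)) fun u v hu hv => ?_
  rw [map_add, coeff_append_re_sq hu hv, coeff_append_im_sq hu hv, coeff_append_re_two_mul hu hv]
  ring

/-- The values at `x₁ = h = 1`, `x₂ = 0` of `Re γ^d` and of its derivative in `x₁`. -/
theorem lift_re_gamma_pow (d : ℕ) :
    FreeAlgebra.lift ℝ (fun v : Option (Fin 2) => if v = some 1 then (0 : ℝ) else 1)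
        (incl (re (gamma ^ d))) = 1 ∧
      FreeAlgebra.lift ℝ (fun v : Option (Fin 2) => if v = some 1 then (0 : ℝ) else 1)
        (dirDeriv 0 (incl (re (gamma ^ d)))) = d := by
  induction d with
  | zero =>
    have h : re (gamma ^ 0) = 1 := by
      refine coeff_injective fun l => ?_
      rw [coeff_re_gamma_pow, ← word_nil, coeff_word]
      cases l <;> simp
    rw [h]
    simp
  | succ d ih =>
    have h1 : incl x₁ = FreeAlgebra.ι ℝ (some 0) := by simp [incl, x₁]
    have h2 : incl x₂ = FreeAlgebra.ι ℝ (some 1) := by simp [incl, x₂]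
    rw [re_gamma_pow_succ, map_sub, map_mul, map_mul, h1, h2, sub_eq_add_neg, ← neg_one_smul ℝ]
    simp only [dirDeriv_add, dirDeriv_smul, dirDeriv_mul, dirDeriv_ι, map_add, map_smul, map_mul,
      lift_ι_apply, ih.1, ih.2, dirVar]
    simp [add_comm]

theorem isSubharmonic_smul_re_sq_iff {d : ℕ} (hd : d ≠ 0) (c : ℝ) :
    IsSubharmonic (c • re (gamma ^ d) ^ 2) ↔ 0 ≤ c := by
  constructor
  · intro h
    rw [IsSubharmonic, lap_smul, lap_sq_of_isHarmonic (isHarmonic_re_gamma_pow d)] at h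
    -- At `x₁ = h = 1`, `x₂ = 0` the derivative in `x₁` has the value `d`, so the Laplacian is `c`
    -- times a positive number.
    have h2 := h.lift_nonneg fun v => if v = some 1 then (0 : ℝ) else 1
    simp only [map_smul, map_add, map_mul, (lift_re_gamma_pow d).2, smul_eq_mul] at h2
    have h3 : (0 : ℝ) < d := by positivity
    by_contra hc
    push Not at hc
    nlinarith [mul_neg_of_neg_of_pos hc (mul_pos h3 h3), mul_nonpos_of_nonpos_of_nonneg hc.le
      (mul_self_nonneg (FreeAlgebra.lift ℝ
        (fun v : Option (Fin 2) => if v = some 1 then (0 : ℝ) else 1)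
        (dirDeriv 1 (incl (re (gamma ^ d))))))]
  · intro hc
    rw [IsSubharmonic, lap_smul]
    exact (isSubharmonic_sq (isSymm_re_gamma_pow d) (isHarmonic_re_gamma_pow d)).smul hc

theorem lap_add_of_isHarmonic {p q : NCPoly (Fin 2)} (hq : IsHarmonic q) :
    lap (p + q) = lap p := by
  rw [lap_add, hq, add_zero]

/-- The coefficients of `p` form a matrix indexed by the left and right halves of a word. Its rows
and columns both have vanishing contractions, so it is determined by its four entries at `z₀`, `z₁`.
Symmetry of `p` identifies the two mixed entries, leaving `c₀`, `c₁`, `c₂`. -/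
theorem isSubharmonic_iff_exists {d : ℕ} (hd : 2 < d) (p : NCPoly (Fin 2)) :
    (p ∈ homogeneous (Fin 2) (2 * d) ∧ IsSubharmonic p) ↔
      ∃ c₀ c₁ c₂ : ℝ, 0 ≤ c₀ ∧ p = c₀ • re (gamma ^ d) ^ 2 + c₁ • re (gamma ^ (2 * d))
        + c₂ • im (gamma ^ (2 * d)) := by
  have hlap : ∀ c₀ c₁ c₂ : ℝ, IsSubharmonic (c₀ • re (gamma ^ d) ^ 2 +
      c₁ • re (gamma ^ (2 * d)) + c₂ • im (gamma ^ (2 * d))) ↔ 0 ≤ c₀ := by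
    intro c₀ c₁ c₂
    rw [IsSubharmonic, lap_add_of_isHarmonic ((isHarmonic_im_gamma_pow _).smul _),
      lap_add_of_isHarmonic ((isHarmonic_re_gamma_pow _).smul _)]
    exact isSubharmonic_smul_re_sq_iff (by omega) c₀
  have hmem : ∀ c₀ c₁ c₂ : ℝ, c₀ • re (gamma ^ d) ^ 2 + c₁ • re (gamma ^ (2 * d))
      + c₂ • im (gamma ^ (2 * d)) ∈ homogeneous (Fin 2) (2 * d) := fun c₀ c₁ c₂ =>
    add_mem (add_mem
      (Submodule.smul_mem _ _ (sq_mem_homogeneous (re_gamma_pow_mem_homogeneous d)))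
      (Submodule.smul_mem _ _ (re_gamma_pow_mem_homogeneous _)))
      (Submodule.smul_mem _ _ (im_gamma_pow_mem_homogeneous _))
  constructor
  · rintro ⟨hp, hs⟩
    have hsymm := isSymm_iff_coeff.mp (isSymm_of_isSymm_lap (by omega) hp hs.1)
    have hright : ∀ z v : List (Fin 2), z.length = d → v.length = d → coeff (z ++ v) p =
        coeff (z ++ List.replicate d 0) p * (Complex.I ^ v.count 1).re +
        coeff (z ++ (List.replicate (d - 1) 0 ++ [1])) p * (Complex.I ^ v.count 1).im := by
      intro z v hz hv
      refine exists_eq_of_contraction_eq_zero hd (fun v => coeff (z ++ v) p) ?_ v hv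
      intro a m b hl
      have := hs.sum_coeff_eq_zero_right hp (a := z ++ a) (m := m) (b := b) (by simp; omega)
        (by simp; omega)
      simpa [List.append_assoc] using this
    have hleft : ∀ u v : List (Fin 2), u.length = d → v.length = d → coeff (u ++ v) p =
        coeff (List.replicate d 0 ++ v) p * (Complex.I ^ u.count 1).re +
        coeff ((List.replicate (d - 1) 0 ++ [1]) ++ v) p * (Complex.I ^ u.count 1).im := by
      intro u v hu hv
      refine exists_eq_of_contraction_eq_zero hd (fun u => coeff (u ++ v) p) ?_ u hu
      intro a m b hl
      have := hs.sum_coeff_eq_zero_left hp (a := a) (m := m) (b := b ++ v) (by simp; omega)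
        (by simp; omega)
      simpa [List.append_assoc] using this
    set z₀ : List (Fin 2) := List.replicate d 0 with hz₀
    set z₁ : List (Fin 2) := List.replicate (d - 1) 0 ++ [1] with hz₁
    have l₀ : z₀.length = d := by simp [hz₀]
    have l₁ : z₁.length = d := by simp [hz₁]; omega
    have hBC : coeff (z₀ ++ z₁) p = coeff (z₁ ++ z₀) p := by
      -- The reverse of `z₁` is a different word, but `hleft` sees a left half only through its
      -- number of letters `x₂`, which is one for both.
      rw [← hsymm, List.reverse_append, hleft _ _ (by simpa) (by simpa)]
      have c₁ : z₁.reverse.count 1 = 1 := by simp [hz₁, List.count_replicate]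
      have r₀ : z₀.reverse = z₀ := by simp [hz₀]
      rw [c₁, r₀]
      simp
    -- The `Im ⊗ Im` part is eliminated through `Re γ^(2d) = (Re γ^d)^2 - (Im γ^d)^2`.
    have hp' : p = (coeff (z₀ ++ z₀) p + coeff (z₁ ++ z₁) p) • re (gamma ^ d) ^ 2 +
        (-coeff (z₁ ++ z₁) p) • re (gamma ^ (2 * d)) +
        coeff (z₀ ++ z₁) p • im (gamma ^ (2 * d)) := by
      refine eq_of_coeff_append_eq hp (hmem _ _ _) fun u v hu hv => ?_
      simp only [map_add, map_smul, coeff_append_re_sq hu hv, coeff_append_re_two_mul hu hv,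
        coeff_append_im_two_mul hu hv, smul_eq_mul]
      rw [hleft u v hu hv, hright z₀ v l₀ hv, hright z₁ v l₁ hv, ← hBC]
      ring
    refine ⟨_, _, _, ?_, hp'⟩
    rwa [hp', hlap] at hs
  · rintro ⟨c₀, c₁, c₂, h₀, rfl⟩
    exact ⟨hmem _ _ _, (hlap _ _ _).mpr h₀⟩

end NCPoly

/-! ### Polynomials of degree two -/

namespace NCPoly

theorem x₁_sq_eq : x₁ ^ 2 = word ℝ [0, 0] := by simp [x₁, pow_two]

theorem x₂_sq_eq : x₂ ^ 2 = word ℝ [1, 1] := by simp [x₂, pow_two]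

theorem x₁_mul_x₂_eq : x₁ * x₂ = word ℝ [0, 1] := by simp [x₁, x₂]

theorem x₂_mul_x₁_eq : x₂ * x₁ = word ℝ [1, 0] := by simp [x₁, x₂]

theorem mem_homogeneous_two_iff (p : NCPoly (Fin 2)) : p ∈ homogeneous (Fin 2) 2 ↔
    ∃ A₁ A₂ A₃ A₄ : ℝ, p = A₁ • x₁ ^ 2 + A₂ • x₂ ^ 2 + A₃ • (x₁ * x₂) + A₄ • (x₂ * x₁) := by
  rw [x₁_sq_eq, x₂_sq_eq, x₁_mul_x₂_eq, x₂_mul_x₁_eq]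
  have hmem : ∀ A₁ A₂ A₃ A₄ : ℝ, A₁ • word ℝ [0, 0] + A₂ • word ℝ [1, 1] + A₃ • word ℝ [0, 1] +
      A₄ • word ℝ [1, 0] ∈ homogeneous (Fin 2) 2 := fun A₁ A₂ A₃ A₄ =>
    add_mem (add_mem (add_mem
      (Submodule.smul_mem _ _ (word_mem_homogeneous [0, 0]))
      (Submodule.smul_mem _ _ (word_mem_homogeneous [1, 1])))
      (Submodule.smul_mem _ _ (word_mem_homogeneous [0, 1])))
      (Submodule.smul_mem _ _ (word_mem_homogeneous [1, 0]))
  constructor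
  · intro hp
    refine ⟨coeff [0, 0] p, coeff [1, 1] p, coeff [0, 1] p, coeff [1, 0] p,
      eq_of_coeff_eq hp (hmem _ _ _ _) fun l hl => ?_⟩
    obtain ⟨x, y, rfl⟩ := List.length_eq_two.mp hl
    fin_cases x <;> fin_cases y <;> simp [-word_cons, coeff_word]
  · rintro ⟨A₁, A₂, A₃, A₄, rfl⟩
    exact hmem _ _ _ _

theorem lap_quadratic (A₁ A₂ A₃ A₄ : ℝ) :
    lap (A₁ • x₁ ^ 2 + A₂ • x₂ ^ 2 + A₃ • (x₁ * x₂) + A₄ • (x₂ * x₁)) =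
      (2 * (A₁ + A₂)) • (star (dirVar (Fin 2)) * dirVar (Fin 2)) := by
  simp only [lap, Fin.sum_univ_two, x₁, x₂, incl, map_add, map_smul, map_mul, pow_two,
    lift_ι_apply, dirDeriv_add, dirDeriv_smul, dirDeriv_mul, dirDeriv_ι, dirVar, star_ι]
  simp [dirDeriv_ι]
  module

theorem isHarmonic_quadratic_iff (A₁ A₂ A₃ A₄ : ℝ) :
    IsHarmonic (A₁ • x₁ ^ 2 + A₂ • x₂ ^ 2 + A₃ • (x₁ * x₂) + A₄ • (x₂ * x₁)) ↔ A₁ + A₂ = 0 := by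
  rw [IsHarmonic, lap_quadratic, smul_eq_zero]
  simp [dirVar, ι_ne_zero]

theorem isSubharmonic_quadratic_iff (A₁ A₂ A₃ A₄ : ℝ) :
    IsSubharmonic (A₁ • x₁ ^ 2 + A₂ • x₂ ^ 2 + A₃ • (x₁ * x₂) + A₄ • (x₂ * x₁)) ↔
      0 ≤ A₁ + A₂ := by
  rw [IsSubharmonic, lap_quadratic]
  constructor
  · intro h
    have := h.lift_nonneg fun _ => 1
    simpa [dirVar] using this
  · intro h
    exact (isMatrixPositive_star_mul_self _).smul (by linarith)

theorem re_gamma_sq : re (gamma ^ 2) = x₁ ^ 2 - x₂ ^ 2 := by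
  refine eq_of_coeff_eq (re_gamma_pow_mem_homogeneous 2) (sub_mem
    (x₁_sq_eq ▸ word_mem_homogeneous [0, 0]) (x₂_sq_eq ▸ word_mem_homogeneous [1, 1]))
    fun l hl => ?_
  rw [x₁_sq_eq, x₂_sq_eq, coeff_re_gamma_pow, if_pos hl, map_sub, coeff_word, coeff_word]
  obtain ⟨x, y, rfl⟩ := List.length_eq_two.mp hl
  fin_cases x <;> fin_cases y <;> simp

theorem im_gamma_sq : im (gamma ^ 2) = x₁ * x₂ + x₂ * x₁ := by
  refine eq_of_coeff_eq (im_gamma_pow_mem_homogeneous 2) (add_mem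
    (x₁_mul_x₂_eq ▸ word_mem_homogeneous [0, 1]) (x₂_mul_x₁_eq ▸ word_mem_homogeneous [1, 0]))
    fun l hl => ?_
  rw [x₁_mul_x₂_eq, x₂_mul_x₁_eq, coeff_im_gamma_pow, if_pos hl, map_add, coeff_word, coeff_word]
  obtain ⟨x, y, rfl⟩ := List.length_eq_two.mp hl
  fin_cases x <;> fin_cases y <;> simp

theorem isHarmonic_two_iff_exists (p : NCPoly (Fin 2)) :
    (p ∈ homogeneous (Fin 2) 2 ∧ IsHarmonic p) ↔
      ∃ a b c : ℝ, p = a • re (gamma ^ 2) + b • im (gamma ^ 2) + c • (x₁ * x₂) := by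
  rw [mem_homogeneous_two_iff, re_gamma_sq, im_gamma_sq]
  constructor
  · rintro ⟨⟨A₁, A₂, A₃, A₄, rfl⟩, h⟩
    rw [isHarmonic_quadratic_iff] at h
    refine ⟨A₁, A₄, A₃ - A₄, ?_⟩
    obtain rfl : A₂ = -A₁ := by linarith
    module
  · rintro ⟨a, b, c, rfl⟩
    have h : a • (x₁ ^ 2 - x₂ ^ 2) + b • (x₁ * x₂ + x₂ * x₁) + c • (x₁ * x₂) =
        a • x₁ ^ 2 + (-a) • x₂ ^ 2 + (b + c) • (x₁ * x₂) + b • (x₂ * x₁) := by module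
    rw [h]
    exact ⟨⟨_, _, _, _, rfl⟩, (isHarmonic_quadratic_iff _ _ _ _).mpr (add_neg_cancel a)⟩

theorem isSubharmonic_two_iff_exists (p : NCPoly (Fin 2)) :
    (p ∈ homogeneous (Fin 2) 2 ∧ IsSubharmonic p) ↔
      ∃ A₁ A₂ A₃ A₄ : ℝ, 0 ≤ A₁ + A₂ ∧
        p = A₁ • x₁ ^ 2 + A₂ • x₂ ^ 2 + A₃ • (x₁ * x₂) + A₄ • (x₂ * x₁) := by
  rw [mem_homogeneous_two_iff]
  constructor
  · rintro ⟨⟨A₁, A₂, A₃, A₄, rfl⟩, h⟩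
    exact ⟨A₁, A₂, A₃, A₄, (isSubharmonic_quadratic_iff _ _ _ _).mp h, rfl⟩
  · rintro ⟨A₁, A₂, A₃, A₄, h, rfl⟩
    exact ⟨⟨_, _, _, _, rfl⟩, (isSubharmonic_quadratic_iff _ _ _ _).mpr h⟩

theorem isSymm_word_iff (l : List (Fin 2)) : IsSymm (word ℝ l) ↔ l.reverse = l := by
  rw [IsSymm, star_word]
  refine ⟨fun h => ?_, fun h => by rw [h]⟩
  have := congrArg (coeff l) h
  rw [coeff_word, coeff_word, if_pos rfl] at this
  by_contra hn
  rw [if_neg hn] at this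
  exact zero_ne_one this

/-! ### Quartics -/

theorem quartic_eq_words (B₁ B₂ B₃ B₄ B₅ B₆ : ℝ) : quartic B₁ B₂ B₃ B₄ B₅ B₆ =
    B₁ • (word ℝ [0, 0, 0, 0] - word ℝ [0, 0, 1, 1] - word ℝ [1, 1, 0, 0] + word ℝ [1, 1, 1, 1])
    + B₂ • (word ℝ [0, 0, 0, 1] + word ℝ [1, 0, 0, 0] - word ℝ [1, 0, 1, 1] - word ℝ [1, 1, 0, 1])
    + B₃ • (word ℝ [0, 0, 1, 0] + word ℝ [0, 1, 0, 0] - word ℝ [0, 1, 1, 1] - word ℝ [1, 1, 1, 0])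
    + B₄ • (word ℝ [0, 1, 0, 1] + word ℝ [1, 0, 1, 0])
    + B₅ • word ℝ [0, 1, 1, 0] + B₆ • word ℝ [1, 0, 0, 1] := by
  simp [quartic, x₁, x₂, pow_succ, mul_assoc]

theorem quartic_mem_homogeneous (B₁ B₂ B₃ B₄ B₅ B₆ : ℝ) :
    quartic B₁ B₂ B₃ B₄ B₅ B₆ ∈ homogeneous (Fin 2) 4 := by
  rw [quartic_eq_words]
  have h : ∀ l : List (Fin 2), l.length = 4 → word ℝ l ∈ homogeneous (Fin 2) 4 := fun l hl =>
    hl ▸ word_mem_homogeneous l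
  refine add_mem (add_mem (add_mem (add_mem (add_mem ?_ ?_) ?_) ?_) ?_) ?_ <;>
    refine Submodule.smul_mem _ _ ?_
  · exact add_mem (sub_mem (sub_mem (h _ rfl) (h _ rfl)) (h _ rfl)) (h _ rfl)
  · exact sub_mem (sub_mem (add_mem (h _ rfl) (h _ rfl)) (h _ rfl)) (h _ rfl)
  · exact sub_mem (sub_mem (add_mem (h _ rfl) (h _ rfl)) (h _ rfl)) (h _ rfl)
  · exact add_mem (h _ rfl) (h _ rfl)
  · exact h _ rfl
  · exact h _ rfl

theorem isSymm_quartic (B₁ B₂ B₃ B₄ B₅ B₆ : ℝ) : IsSymm (quartic B₁ B₂ B₃ B₄ B₅ B₆) := by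
  rw [quartic_eq_words, IsSymm]
  simp only [star_add, star_sub, star_smul_real, star_word, List.reverse_cons, List.reverse_nil,
    List.nil_append, List.cons_append]
  module

theorem eq_zero_of_quartic_eq_zero {B₁ B₂ B₃ B₄ B₅ B₆ : ℝ}
    (h : quartic B₁ B₂ B₃ B₄ B₅ B₆ = 0) :
    B₁ = 0 ∧ B₂ = 0 ∧ B₃ = 0 ∧ B₄ = 0 ∧ B₅ = 0 ∧ B₆ = 0 := by
  have key := fun l => congrArg (coeff l) h
  rw [quartic_eq_words] at key
  simp only [map_add, map_sub, map_smul, map_zero, coeff_word] at key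
  refine ⟨?_, ?_, ?_, ?_, ?_, ?_⟩
  · simpa using key [0, 0, 0, 0]
  · simpa using key [0, 0, 0, 1]
  · simpa using key [0, 0, 1, 0]
  · simpa using key [0, 1, 0, 1]
  · simpa using key [0, 1, 1, 0]
  · simpa using key [1, 0, 0, 1]

/-- Half words have only two letters, so the only available contractions are those of the first two
and of the last two letters. Symmetry leaves ten of the sixteen coefficients, and these contractions
impose four further relations. -/
theorem exists_eq_quartic {p : NCPoly (Fin 2)} (hp : p ∈ homogeneous (Fin 2) 4) (hs : IsSymm p)
    (hsub : IsSubharmonic p) : ∃ B₁ B₂ B₃ B₄ B₅ B₆ : ℝ, p = quartic B₁ B₂ B₃ B₄ B₅ B₆ := by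
  refine ⟨coeff [0, 0, 0, 0] p, coeff [0, 0, 0, 1] p, coeff [0, 0, 1, 0] p,
    coeff [0, 1, 0, 1] p, coeff [0, 1, 1, 0] p, coeff [1, 0, 0, 1] p, ?_⟩
  have hright : ∀ x y : Fin 2, coeff [x, y, 0, 0] p + coeff [x, y, 1, 1] p = 0 := by
    intro x y
    have := hsub.sum_coeff_eq_zero_right (d := 2) hp (a := [x, y]) (m := []) (b := [])
      (by simp) (by simp)
    simpa [Fin.sum_univ_two] using this
  have hleft : ∀ x y : Fin 2, coeff [0, 0, x, y] p + coeff [1, 1, x, y] p = 0 := by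
    intro x y
    have := hsub.sum_coeff_eq_zero_left (d := 2) hp (a := []) (m := []) (b := [x, y])
      (by simp) (by simp)
    simpa [Fin.sum_univ_two] using this
  have hrev : ∀ x y z w : Fin 2, coeff [x, y, z, w] p = coeff [w, z, y, x] p := by
    intro x y z w
    simpa using isSymm_iff_coeff.mp hs [w, z, y, x]
  refine eq_of_coeff_eq hp (quartic_mem_homogeneous _ _ _ _ _ _) fun l hl => ?_
  rw [quartic_eq_words]
  simp only [map_add, map_sub, map_smul, coeff_word]
  obtain ⟨x, y, z, w, rfl⟩ : ∃ x y z w, l = [x, y, z, w] := by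
    match l, hl with
    | [x, y, z, w], _ => exact ⟨x, y, z, w, rfl⟩
  have r00 := hright 0 0
  have r01 := hright 0 1
  have r10 := hright 1 0
  have r11 := hright 1 1
  have l00 := hleft 0 0
  have l01 := hleft 0 1
  have l10 := hleft 1 0
  have l11 := hleft 1 1
  have s1 := hrev 0 0 0 1
  have s2 := hrev 0 0 1 0
  have s3 := hrev 0 1 0 1
  have s4 := hrev 0 0 1 1
  have s5 := hrev 1 0 1 1
  have s6 := hrev 0 1 1 1
  fin_cases x <;> fin_cases y <;> fin_cases z <;> fin_cases w <;>
    simp <;> linarith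

/-- Half the Laplacian of a quartic of the six-parameter family. -/
def quarticLap (P Q t e : ℝ) (a b h : WithDir (Fin 2)) : WithDir (Fin 2) :=
  P • (a * (h * (h * a)) + h * (b * (b * h))) + Q • (b * (h * (h * b)) + h * (a * (a * h)))
    + t • (a * (h * (h * b)) + b * (h * (h * a)) - h * (a * (b * h)) - h * (b * (a * h)))
    + e • (h * (a * (h * a)) + a * (h * (a * h)) + h * (b * (h * b)) + b * (h * (b * h)))

theorem lap_quartic (B₁ B₂ B₃ B₄ B₅ B₆ : ℝ) : lap (quartic B₁ B₂ B₃ B₄ B₅ B₆) =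
    (2 : ℝ) • quarticLap (B₁ + B₅) (B₁ + B₆) (B₂ - B₃) (B₁ + B₄) (FreeAlgebra.ι ℝ (some 0))
      (FreeAlgebra.ι ℝ (some 1)) (dirVar (Fin 2)) := by
  rw [quartic_eq_words]
  simp only [lap_add, lap_sub, lap_smul]
  simp only [lap, Fin.sum_univ_two, incl_word, List.map_cons, List.map_nil]
  simp [dirDeriv_mul, dirDeriv_ι, dirVar, quarticLap, mul_add]
  module

/-- This completes the square in `h a` and `b h`, with `P` multiplied in to avoid division. The `t *
e` cross terms of the two squares cancel, so the remainder is diagonal in `h b` and `a h`. -/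
theorem quarticLap_sos {P Q t e : ℝ} (a b h : WithDir (Fin 2)) (ha : star a = a) (hb : star b = b)
    (hh : star h = h) : P • quarticLap P Q t e a b h =
      star (P • (h * a) + t • (h * b) + e • (a * h)) * (P • (h * a) + t • (h * b) + e • (a * h)) +
      star (P • (b * h) - t • (a * h) + e • (h * b)) * (P • (b * h) - t • (a * h) + e • (h * b)) +
      (P * Q - (t ^ 2 + e ^ 2)) • (star (h * b) * (h * b) + star (a * h) * (a * h)) := by
  simp only [star_add, star_sub, star_smul_real, star_mul, ha, hb, hh, quarticLap, mul_add, add_mul,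
    mul_sub, sub_mul, smul_mul_assoc, mul_smul_comm, mul_assoc]
  module

theorem isMatrixPositive_quarticLap {P Q t e : ℝ} (hP : 0 ≤ P) (hQ : 0 ≤ Q)
    (hPQ : t ^ 2 + e ^ 2 ≤ P * Q) {a b h : WithDir (Fin 2)} (ha : star a = a) (hb : star b = b)
    (hh : star h = h) : IsMatrixPositive (quarticLap P Q t e a b h) := by
  rcases hP.eq_or_lt with rfl | hP
  -- When `P = 0` the determinant condition forces `t = e = 0` and only the `Q` terms remain.
  · obtain rfl : t = 0 := by nlinarith
    obtain rfl : e = 0 := by nlinarith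
    have : quarticLap 0 Q 0 0 a b h = Q • (star (h * b) * (h * b) + star (a * h) * (a * h)) := by
      simp only [quarticLap, star_mul, ha, hb, hh, mul_assoc]
      module
    rw [this]
    exact ((isMatrixPositive_star_mul_self _).add (isMatrixPositive_star_mul_self _)).smul hQ
  · have : quarticLap P Q t e a b h = P⁻¹ • (P • quarticLap P Q t e a b h) := by
      rw [smul_smul, inv_mul_cancel₀ hP.ne', one_smul]
    rw [this, quarticLap_sos a b h ha hb hh]
    refine IsMatrixPositive.smul ?_ (inv_nonneg.mpr hP.le)
    exact ((isMatrixPositive_star_mul_self _).add (isMatrixPositive_star_mul_self _)).add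
      (((isMatrixPositive_star_mul_self _).add (isMatrixPositive_star_mul_self _)).smul
        (by linarith))

/-- The quadratic form obtained from the middle matrix of a quartic's Laplacian. -/
theorem IsMatrixPositive.quarticLap_form_nonneg {P Q t e : ℝ}
    (hpos : IsMatrixPositive (quarticLap P Q t e (FreeAlgebra.ι ℝ (some 0))
      (FreeAlgebra.ι ℝ (some 1)) (dirVar (Fin 2)))) (z₁ z₂ y₁ y₂ : ℝ) :
    0 ≤ P * (z₁ ^ 2 + y₂ ^ 2) + Q * (z₂ ^ 2 + y₁ ^ 2) + 2 * t * (z₁ * z₂ - y₁ * y₂) +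
      2 * e * (y₁ * z₁ + y₂ * z₂) := by
  -- On the basis vector `e₀`, the products `H A`, `H B`, `A H`, `B H` give `z₁`, `z₂`, `y₁`, `y₂`
  -- times `e₄`: the four border words take arbitrary independent values on one line. The corner
  -- entry of the evaluation is then the quadratic form.
  let A : Matrix (Fin 5) (Fin 5) ℝ :=
    !![0, 0, 1, 0, 0; 0, 0, 0, 0, y₁; 1, 0, 0, 0, 0; 0, 0, 0, 0, 0; 0, y₁, 0, 0, 0]
  let B : Matrix (Fin 5) (Fin 5) ℝ :=
    !![0, 0, 0, 1, 0; 0, 0, 0, 0, y₂; 0, 0, 0, 0, 0; 1, 0, 0, 0, 0; 0, y₂, 0, 0, 0]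
  let H : Matrix (Fin 5) (Fin 5) ℝ :=
    !![0, 1, 0, 0, 0; 1, 0, 0, 0, 0; 0, 0, 0, 0, z₁; 0, 0, 0, 0, z₂; 0, 0, z₁, z₂, 0]
  let X : Option (Fin 2) → Matrix (Fin 5) (Fin 5) ℝ := fun v => v.elim H ![A, B]
  have hX : ∀ i, (X i).IsSymm := by
    rintro (_ | i)
    · ext i j; fin_cases i <;> fin_cases j <;> rfl
    · fin_cases i <;> ext i j <;> fin_cases i <;> fin_cases j <;> rfl
  have h := (hpos.2 5 X hX).diag_nonneg (i := 0)
  simp only [evalMat, quarticLap, dirVar, map_add, map_sub, map_smul, map_mul, lift_ι_apply] at h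
  change 0 ≤ (P • (A * (H * (H * A)) + H * (B * (B * H))) + Q • (B * (H * (H * B)) +
    H * (A * (A * H))) + t • (A * (H * (H * B)) + B * (H * (H * A)) - H * (A * (B * H)) -
    H * (B * (A * H))) + e • (H * (A * (H * A)) + A * (H * (A * H)) + H * (B * (H * B)) +
    B * (H * (B * H)))) 0 0 at h
  simp [A, B, H] at h
  linarith

theorem IsMatrixPositive.of_quarticLap {P Q t e : ℝ}
    (hpos : IsMatrixPositive (quarticLap P Q t e (FreeAlgebra.ι ℝ (some 0))
      (FreeAlgebra.ι ℝ (some 1)) (dirVar (Fin 2)))) :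
    t ^ 2 + e ^ 2 ≤ P * Q ∧ 0 ≤ Q ∧ 0 ≤ P := by
  have key := hpos.quarticLap_form_nonneg
  have hP := key 1 0 0 0
  have hQ := key 0 1 0 0
  norm_num at hP hQ
  refine ⟨?_, hQ, hP⟩
  -- The first two vectors give the form the values `P * (P * Q - t ^ 2 - e ^ 2)` and `Q * (P * Q -
  -- t ^ 2 - e ^ 2)`. If the bracket were negative, both `P` and `Q` would vanish, and then the
  -- third vector gives `-2 * (t ^ 2 + e ^ 2)`.
  have h1 := key t (-P) 0 e
  have h2 := key (-Q) t e 0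
  have h3 := key t (-1) 0 e
  by_contra! hlt
  have hP0 : P = 0 := by
    by_contra hne
    have := mul_pos (lt_of_le_of_ne hP (Ne.symm hne)) (sub_pos.mpr hlt)
    nlinarith
  have hQ0 : Q = 0 := by
    by_contra hne
    have := mul_pos (lt_of_le_of_ne hQ (Ne.symm hne)) (sub_pos.mpr hlt)
    nlinarith
  rw [hP0, hQ0] at h3 hlt
  nlinarith

theorem isSubharmonic_quartic_iff (B₁ B₂ B₃ B₄ B₅ B₆ : ℝ) :
    IsSubharmonic (quartic B₁ B₂ B₃ B₄ B₅ B₆) ↔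
      (B₃ - B₂) ^ 2 + (B₁ + B₄) ^ 2 ≤ (B₁ + B₆) * (B₁ + B₅) ∧ 0 ≤ B₁ + B₆ ∧ 0 ≤ B₁ + B₅ := by
  rw [IsSubharmonic, lap_quartic, mul_comm (B₁ + B₆), sub_sq_comm]
  constructor
  · intro h
    have := h.smul (r := 2⁻¹) (by norm_num)
    rw [smul_smul, inv_mul_cancel₀ two_ne_zero, one_smul] at this
    exact this.of_quarticLap
  · rintro ⟨h, hQ, hP⟩
    exact (isMatrixPositive_quarticLap hP hQ h (star_ι _) (star_ι _) (star_ι _)).smul two_pos.le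

theorem isSymm_and_isSubharmonic_four_iff_exists (p : NCPoly (Fin 2)) :
    (p ∈ homogeneous (Fin 2) 4 ∧ IsSymm p ∧ IsSubharmonic p) ↔
      ∃ B₁ B₂ B₃ B₄ B₅ B₆ : ℝ, p = quartic B₁ B₂ B₃ B₄ B₅ B₆ ∧
        (B₃ - B₂) ^ 2 + (B₁ + B₄) ^ 2 ≤ (B₁ + B₆) * (B₁ + B₅) ∧
        0 ≤ B₁ + B₆ ∧ 0 ≤ B₁ + B₅ := by
  constructor
  · rintro ⟨hp, hs, hsub⟩
    obtain ⟨B₁, B₂, B₃, B₄, B₅, B₆, rfl⟩ := exists_eq_quartic hp hs hsub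
    exact ⟨B₁, B₂, B₃, B₄, B₅, B₆, rfl, (isSubharmonic_quartic_iff _ _ _ _ _ _).mp hsub⟩
  · rintro ⟨B₁, B₂, B₃, B₄, B₅, B₆, rfl, h⟩
    exact ⟨quartic_mem_homogeneous _ _ _ _ _ _, isSymm_quartic _ _ _ _ _ _,
      (isSubharmonic_quartic_iff _ _ _ _ _ _).mpr h⟩

theorem pos_iff_pos_of_add_sq_lt_mul {a b P Q : ℝ} (h : a ^ 2 + b ^ 2 < P * Q) :
    0 < P ↔ 0 < Q := by
  have hPQ : 0 < P * Q := by nlinarith [sq_nonneg a, sq_nonneg b]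
  exact pos_iff_pos_of_mul_pos hPQ

end NCPoly

end

theorem theorem1p1 :
    -- (1a) harmonics of degree `d > 2`
    (∀ d : ℕ, 2 < d → ∀ p : NCPoly (Fin 2),
      (p ∈ NCPoly.homogeneous (Fin 2) d ∧ NCPoly.IsHarmonic p) ↔
        ∃ a b : ℝ, p = a • NCPoly.re (NCPoly.gamma ^ d) + b • NCPoly.im (NCPoly.gamma ^ d)) ∧
    -- (1b) harmonics of degree 2
    (∀ p : NCPoly (Fin 2),
      (p ∈ NCPoly.homogeneous (Fin 2) 2 ∧ NCPoly.IsHarmonic p) ↔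
        ∃ a b c : ℝ, p = a • NCPoly.re (NCPoly.gamma ^ 2) + b • NCPoly.im (NCPoly.gamma ^ 2)
          + c • (NCPoly.x₁ * NCPoly.x₂)) ∧
    -- `x₂ x₁` is one of the combinations in (1b)
    (∃ a b c : ℝ, NCPoly.x₂ * NCPoly.x₁ =
      a • NCPoly.re (NCPoly.gamma ^ 2) + b • NCPoly.im (NCPoly.gamma ^ 2)
        + c • (NCPoly.x₁ * NCPoly.x₂)) ∧
    -- (2a) subharmonics of degree `2 d` with `d > 2`
    (∀ d : ℕ, 2 < d → ∀ p : NCPoly (Fin 2),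
      (p ∈ NCPoly.homogeneous (Fin 2) (2 * d) ∧ NCPoly.IsSubharmonic p) ↔
        ∃ c₀ c₁ c₂ : ℝ, 0 ≤ c₀ ∧
          p = c₀ • NCPoly.re (NCPoly.gamma ^ d) ^ 2 + c₁ • NCPoly.re (NCPoly.gamma ^ (2 * d))
            + c₂ • NCPoly.im (NCPoly.gamma ^ (2 * d))) ∧
    -- the two expressions in (2a) agree
    (∀ d : ℕ, 2 < d → ∀ c₀ c₁ c₂ : ℝ,
      c₀ • NCPoly.re (NCPoly.gamma ^ d) ^ 2 + c₁ • NCPoly.re (NCPoly.gamma ^ (2 * d))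
          + c₂ • NCPoly.im (NCPoly.gamma ^ (2 * d)) =
        c₀ • NCPoly.im (NCPoly.gamma ^ d) ^ 2 + (c₀ + c₁) • NCPoly.re (NCPoly.gamma ^ (2 * d))
          + c₂ • NCPoly.im (NCPoly.gamma ^ (2 * d))) ∧
    -- (2b) symmetric subharmonics of degree 4
    (∀ p : NCPoly (Fin 2),
      (p ∈ NCPoly.homogeneous (Fin 2) 4 ∧ NCPoly.IsSymm p ∧ NCPoly.IsSubharmonic p) ↔
        ∃ B₁ B₂ B₃ B₄ B₅ B₆ : ℝ,
          p = NCPoly.quartic B₁ B₂ B₃ B₄ B₅ B₆ ∧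
          (B₃ - B₂) ^ 2 + (B₁ + B₄) ^ 2 ≤ (B₁ + B₆) * (B₁ + B₅) ∧
          0 ≤ B₁ + B₆ ∧ 0 ≤ B₁ + B₅) ∧
    -- the two sign conditions in (2b) are equivalent when the quadratic inequality is strict
    (∀ B₁ B₂ B₃ B₄ B₅ B₆ : ℝ,
      (B₃ - B₂) ^ 2 + (B₁ + B₄) ^ 2 < (B₁ + B₆) * (B₁ + B₅) →
        (0 < B₁ + B₆ ↔ 0 < B₁ + B₅)) ∧
    -- the six parameters in (2b) are independent
    (∀ B₁ B₂ B₃ B₄ B₅ B₆ : ℝ, NCPoly.quartic B₁ B₂ B₃ B₄ B₅ B₆ = 0 →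
      B₁ = 0 ∧ B₂ = 0 ∧ B₃ = 0 ∧ B₄ = 0 ∧ B₅ = 0 ∧ B₆ = 0) ∧
    -- (2c) subharmonics of degree 2
    (∀ p : NCPoly (Fin 2),
      (p ∈ NCPoly.homogeneous (Fin 2) 2 ∧ NCPoly.IsSubharmonic p) ↔
        ∃ A₁ A₂ A₃ A₄ : ℝ, 0 ≤ A₁ + A₂ ∧
          p = A₁ • NCPoly.x₁ ^ 2 + A₂ • NCPoly.x₂ ^ 2 + A₃ • (NCPoly.x₁ * NCPoly.x₂)
            + A₄ • (NCPoly.x₂ * NCPoly.x₁)) ∧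
    -- (3) no pure subharmonics of odd degree
    (∀ d : ℕ, Odd d → ∀ p : NCPoly (Fin 2), p ∈ NCPoly.homogeneous (Fin 2) d →
      ¬ NCPoly.IsPurelySubharmonic p) ∧
    -- all the listed functions except `x₁ x₂` and `x₂ x₁` are symmetric
    (∀ d : ℕ, NCPoly.IsSymm (NCPoly.re (NCPoly.gamma ^ d)) ∧
      NCPoly.IsSymm (NCPoly.im (NCPoly.gamma ^ d)) ∧
      NCPoly.IsSymm (NCPoly.re (NCPoly.gamma ^ d) ^ 2) ∧
      NCPoly.IsSymm (NCPoly.im (NCPoly.gamma ^ d) ^ 2)) ∧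
    (∀ B₁ B₂ B₃ B₄ B₅ B₆ : ℝ, NCPoly.IsSymm (NCPoly.quartic B₁ B₂ B₃ B₄ B₅ B₆)) ∧
    NCPoly.IsSymm (NCPoly.x₁ ^ 2) ∧ NCPoly.IsSymm (NCPoly.x₂ ^ 2) ∧
    ¬ NCPoly.IsSymm (NCPoly.x₁ * NCPoly.x₂) ∧ ¬ NCPoly.IsSymm (NCPoly.x₂ * NCPoly.x₁) := by
  open NCPoly in
  refine ⟨fun d hd p => isHarmonic_iff_exists hd p, isHarmonic_two_iff_exists, ?_,
    fun d hd p => isSubharmonic_iff_exists hd p, ?_, isSymm_and_isSubharmonic_four_iff_exists,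
    fun _ _ _ _ _ _ h => pos_iff_pos_of_add_sq_lt_mul h,
    fun _ _ _ _ _ _ h => eq_zero_of_quartic_eq_zero h, isSubharmonic_two_iff_exists,
    fun d hd p hp => not_isPurelySubharmonic_of_odd hd hp,
    fun d => ⟨isSymm_re_gamma_pow d, isSymm_im_gamma_pow d, (isSymm_re_gamma_pow d).sq,
      (isSymm_im_gamma_pow d).sq⟩, isSymm_quartic, ?_, ?_, ?_, ?_⟩
  · refine ⟨0, 1, -1, ?_⟩
    rw [im_gamma_sq]
    module
  · intro d _ c₀ c₁ c₂
    rw [re_sq_eq]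
    module
  · rw [x₁_sq_eq, isSymm_word_iff]
    rfl
  · rw [x₂_sq_eq, isSymm_word_iff]
    rfl
  · rw [x₁_mul_x₂_eq, isSymm_word_iff]
    simp
  · rw [x₂_mul_x₁_eq, isSymm_word_iff]
    simp
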